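/- **Notation.** All Hilbert spaces are finite-dimensional and $\log=\log_2$ with $\log 0=-\infty$. $\mathrm{Sep}$ is the set of separable states of a bipartite system (for $n$ copies, with respect to the cut $A^n:B^n$), $\mathrm{cone}(\mathrm{Sep})=\{\lambda\sigma:\lambda\ge 0,\sigma\in\mathrm{Sep}\}$, $\overline{\mathrm{Sep}}=\{\lambda\sigma:0\le\lambda\le1,\sigma\in\mathrm{Sep}\}$. For positive semidefinite $X,Y$ let $\Omega(X,Y)=\inf\{\gamma\ge0: X\le\eta Y\le\gamma X\text{ for some }\eta\ge0\}$ if $\mathrm{supp}X=\mathrm{supp}Y$ and $\Omega(X,Y)=\infty$ otherwise, and let $D_\Omega=\log\Omega$ be the Hilbert projective metric. $\Psi_m=|\psi_m\rangle\langle\psi_m|$ with $|\psi_m\rangle=m^{-1/2}\sum_{i=1}^m|ii\rangle$ is the maximally entangled state on $\mathbb C^m\otimes\mathbb C^m$, and $F(\rho,\sigma)=\|\sqrt\rho\sqrt\sigma\|_1$. For $\delta\ge0$, $\mathbb O_{\mathcal{DNE}_\delta}$ is the set of $\delta$-approximately dually nonentangling instruments: finite families $(\mathcal E_i)$ of completely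 positive maps between bipartite systems whose sum is trace preserving, such that for every $i$ and every $\sigma\in\mathrm{Sep}$ one has $\inf_{s\in\overline{\mathrm{Sep}}}D_\Omega(\mathcal E_i(\sigma),s)\le\delta$, and for every $i$ and every $\sigma\in\mathrm{Sep}$ of the output system $\mathcal E_i^\dagger(\sigma)\in\mathrm{cone}(\mathrm{Sep})$. For $m\ge2$ put $$E^{(m),\mathcal{DNE}_\delta}_{d,err,p}(\rho)=\sup\ \lim_{n\to\infty}-\tfrac1n\log\epsilon_n ,$$ the supremum being over all sequences $\epsilon_n\ge0$ for which the limit exists in $[-\infty,\infty]$ and for which, for every $n\ge1$, there are an instrument $\mathcal E\in\mathbb O_{\mathcal{DNE}_\delta}$ from $A^n:B^n$ to $\mathbb C^m\otimes\mathbb C^m$ and an index $i$ with $\mathrm{tr}\,\mathcal E_i(\rho^{\otimes n})>0$ and $F\big(\mathcal E_i(\rho^{\otimes n})/\mathrm{tr}\,\mathcal E_i(\rho^{\otimes n}),\Psi_m\big)\ge1-\epsilon_n$. The asymptotic error exponent of probabilistic entanglement distillation is $E^{\mathcal{DNE}_\delta}_{d,err,p}(\rho)=\lim_{m\to\infty}E^{(m),\mathcal{DNE}_\delta}_{d,err,p}(\rho)$.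 Let $\mathbb{SEP}$ be the set of separable measurements, i.e. finite POVMs $M=(M_x)$ with all $M_x\in\mathrm{cone}(\mathrm{Sep})$; write $M(X)=\sum_x\mathrm{tr}(M_xX)|x\rangle\langle x|$ and $$\hat\Omega^{\mathbb{SEP}}_{Sep}(\rho)=\inf_{\sigma\in\mathrm{Sep}}\ \sup_{M\in\mathbb{SEP}}\Omega(M(\sigma),M(\rho)).$$ **Theorem 2.** Let $\rho$ be a state of a bipartite system $AB$ and $\delta\ge0$. Then the limit $$\hat D^{reg,\mathbb{SEP}}_{\Omega,Sep}(\rho):=\lim_{n\to\infty}\tfrac1n\log\hat\Omega^{\mathbb{SEP}}_{Sep}(\rho^{\otimes n})$$ exists in $[-\infty,\infty]$, and $$E^{(m),\mathcal{DNE}_\delta}_{d,err,p}(\rho)=\hat D^{reg,\mathbb{SEP}}_{\Omega,Sep}(\rho)\quad\text{for every integer }m\ge2 .$$ Consequently the limit $m\to\infty$ exists and $$E^{\mathcal{DNE}_\delta}_{d,err,p}(\rho)=\hat D^{reg,\mathbb{SEP}}_{\Omega,Sep}(\rho).$$ -/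

import Mathlib

open scoped NNReal ENNReal MatrixOrder ComplexOrder Kronecker

noncomputable section

namespace Distill

/-- The base-two logarithm `[0, ∞] → [-∞, ∞]`, with `log₂ 0 = -∞` and `log₂ ∞ = ∞`. -/
def log2 (x : ℝ≥0∞) : EReal :=
  ENNReal.log x / ((Real.log 2 : ℝ) : EReal)

/-! ### States and separability -/

/-- A quantum state (density matrix). -/
def IsState {ι : Type*} [Fintype ι] (ρ : Matrix ι ι ℂ) : Prop :=
  ρ.PosSemidef ∧ ρ.trace = 1

/-- Separable states of a bipartite system: finite convex combinations of product states. -/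
def IsSep {a b : Type*} [Fintype a] [Fintype b] (σ : Matrix (a × b) (a × b) ℂ) : Prop :=
  ∃ (k : ℕ) (p : Fin k → ℝ) (α : Fin k → Matrix a a ℂ) (β : Fin k → Matrix b b ℂ),
    (∀ i, 0 ≤ p i) ∧ ∑ i, p i = 1 ∧ (∀ i, IsState (α i)) ∧ (∀ i, IsState (β i)) ∧
      σ = ∑ i, p i • (α i ⊗ₖ β i)

/-- The (closed) convex cone generated by the separable states. -/
def InSepCone {a b : Type*} [Fintype a] [Fintype b] (X : Matrix (a × b) (a × b) ℂ) : Prop :=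
  ∃ (t : ℝ) (σ : Matrix (a × b) (a × b) ℂ), 0 ≤ t ∧ IsSep σ ∧ X = t • σ

/-- Separable substates: separable positive operators of trace at most one. -/
def IsSubSep {a b : Type*} [Fintype a] [Fintype b] (X : Matrix (a × b) (a × b) ℂ) : Prop :=
  ∃ (t : ℝ) (σ : Matrix (a × b) (a × b) ℂ), 0 ≤ t ∧ t ≤ 1 ∧ IsSep σ ∧ X = t • σ

/-- The `n`-fold tensor power `ρ^{⊗ n}` of a bipartite operator, as an operator on the bipartite
system `A^n : B^n`. -/
def tensorPow {a b : Type*} (n : ℕ) (ρ : Matrix (a × b) (a × b) ℂ) :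
    Matrix ((Fin n → a) × (Fin n → b)) ((Fin n → a) × (Fin n → b)) ℂ :=
  Matrix.of fun x y => ∏ t, ρ (x.1 t, x.2 t) (y.1 t, y.2 t)

/-- The vector `|ψ_m⟩ = m^{-1/2} ∑ᵢ |i i⟩`. -/
def maxEntVec (m : ℕ) : Fin m × Fin m → ℂ :=
  fun x => if x.1 = x.2 then (((Real.sqrt m)⁻¹ : ℝ) : ℂ) else 0

/-- The maximally entangled state `Ψ_m = |ψ_m⟩⟨ψ_m|`. -/
def maxEnt (m : ℕ) : Matrix (Fin m × Fin m) (Fin m × Fin m) ℂ :=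
  Matrix.vecMulVec (maxEntVec m) (star (maxEntVec m))

/-- The trace norm `‖X‖₁ = tr √(X†X)`. -/
def traceNorm {ι : Type*} [Fintype ι] [DecidableEq ι] (X : Matrix ι ι ℂ) : ℝ :=
  (CFC.sqrt (X.conjTranspose * X)).trace.re

/-- The fidelity `F(ρ, σ) = ‖√ρ √σ‖₁`. -/
def fidelity {ι : Type*} [Fintype ι] [DecidableEq ι] (ρ σ : Matrix ι ι ℂ) : ℝ :=
  traceNorm (CFC.sqrt ρ * CFC.sqrt σ)

/-! ### Hilbert projective metric -/

/-- Two operators have the same kernel; for Hermitian operators, equivalently the same support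
(the support being the orthogonal complement of the kernel). -/
def SameSupport {ι : Type*} [Fintype ι] (X Y : Matrix ι ι ℂ) : Prop :=
  ∀ v : ι → ℂ, X.mulVec v = 0 ↔ Y.mulVec v = 0

/-- `Ω(X, Y) = inf {γ ≥ 0 | X ≤ η Y ≤ γ X for some η ≥ 0}` if the supports agree, else `∞`
(the infimum over the empty set). -/
def hilbertOmega {ι : Type*} [Fintype ι] (X Y : Matrix ι ι ℂ) : ℝ≥0∞ :=
  ⨅ (γ : ℝ≥0) (_ : SameSupport X Y ∧ ∃ η : ℝ≥0,
    ((η : ℝ) • Y - X).PosSemidef ∧ ((γ : ℝ) • X - (η : ℝ) • Y).PosSemidef), (γ : ℝ≥0∞)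

/-- The Hilbert projective metric `D_Ω = log₂ Ω`. -/
def hilbertD {ι : Type*} [Fintype ι] (X Y : Matrix ι ι ℂ) : EReal :=
  log2 (hilbertOmega X Y)

/-- The Hilbert projective metric between `X` and the set of separable substates. -/
def hilbertDSubSep {a b : Type*} [Fintype a] [Fintype b]
    (X : Matrix (a × b) (a × b) ℂ) : EReal :=
  ⨅ (s : Matrix (a × b) (a × b) ℂ) (_ : IsSubSep s), hilbertD X s

/-! ### Instruments -/

/-- The ampliation `id_k ⊗ Φ`, acting blockwise. -/
def ampliation {ι κ : Type*} (k : ℕ) (Φ : Matrix ι ι ℂ →ₗ[ℂ] Matrix κ κ ℂ)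
    (X : Matrix (Fin k × ι) (Fin k × ι) ℂ) : Matrix (Fin k × κ) (Fin k × κ) ℂ :=
  Matrix.of fun x y => Φ (Matrix.of fun i j => X (x.1, i) (y.1, j)) x.2 y.2

/-- Complete positivity: every ampliation preserves positive semidefiniteness. -/
def IsCP {ι κ : Type*} [Fintype ι] [Fintype κ]
    (Φ : Matrix ι ι ℂ →ₗ[ℂ] Matrix κ κ ℂ) : Prop :=
  ∀ (k : ℕ) (X : Matrix (Fin k × ι) (Fin k × ι) ℂ),
    X.PosSemidef → (ampliation k Φ X).PosSemidef

/-- A quantum instrument: finitely many completely positive maps whose sum preserves the trace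
(each of them is then trace nonincreasing). -/
def IsInstrument {ι κ : Type*} [Fintype ι] [Fintype κ] {k : ℕ}
    (E : Fin k → (Matrix ι ι ℂ →ₗ[ℂ] Matrix κ κ ℂ)) : Prop :=
  (∀ i, IsCP (E i)) ∧ ∀ X : Matrix ι ι ℂ, ∑ i, (E i X).trace = X.trace

/-- The Heisenberg-picture map `Φ†`, determined by `tr (X Φ(Y)) = tr (Φ†(X) Y)`; see
`trace_heisenberg_mul`. -/
def heisenberg {ι κ : Type*} [Fintype κ] [DecidableEq ι]
    (Φ : Matrix ι ι ℂ →ₗ[ℂ] Matrix κ κ ℂ) (X : Matrix κ κ ℂ) : Matrix ι ι ℂ :=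
  Matrix.of fun i j => (X * Φ (Matrix.single j i 1)).trace

theorem trace_heisenberg_mul {ι κ : Type*} [Fintype ι] [Fintype κ] [DecidableEq ι]
    (Φ : Matrix ι ι ℂ →ₗ[ℂ] Matrix κ κ ℂ) (X : Matrix κ κ ℂ) (Y : Matrix ι ι ℂ) :
    (heisenberg Φ X * Y).trace = (X * Φ Y).trace := by
  have h : Φ Y = ∑ j, ∑ i, Y j i • Φ (Matrix.single j i 1) := by
    conv_lhs => rw [Matrix.matrix_eq_sum_single Y]
    simp only [map_sum, ← map_smul, Matrix.smul_single, smul_eq_mul, mul_one]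
  rw [h]
  simp only [Finset.mul_sum, Matrix.trace_sum, Matrix.mul_smul, Matrix.trace_smul, smul_eq_mul]
  rw [Finset.sum_comm]
  simp only [Matrix.trace, Matrix.diag_apply, Matrix.mul_apply, heisenberg, Matrix.of_apply]
  refine Finset.sum_congr rfl fun i _ => Finset.sum_congr rfl fun j _ => ?_
  ring

/-- `E` is a `δ`-approximately nonentangling instrument. -/
def IsApproxNE {a b c d : Type*} [Fintype a] [Fintype b] [Fintype c] [Fintype d] {k : ℕ}
    (δ : ℝ) (E : Fin k → (Matrix (a × b) (a × b) ℂ →ₗ[ℂ] Matrix (c × d) (c × d) ℂ)) : Prop :=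
  IsInstrument E ∧ ∀ i σ, IsSep σ → hilbertDSubSep (E i σ) ≤ (δ : EReal)

/-- `E` is a `δ`-approximately dually nonentangling instrument. -/
def IsApproxDNE {a b c d : Type*} [Fintype a] [Fintype b] [Fintype c] [Fintype d]
    [DecidableEq a] [DecidableEq b] {k : ℕ}
    (δ : ℝ) (E : Fin k → (Matrix (a × b) (a × b) ℂ →ₗ[ℂ] Matrix (c × d) (c × d) ℂ)) : Prop :=
  IsApproxNE δ E ∧ ∀ i σ, IsSep σ → InSepCone (heisenberg (E i) σ)

/-! ### Probabilistic entanglement distillation -/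

/-- Some branch of some `δ`-approximately dually nonentangling instrument maps the state `ρ`, with
nonzero probability, to a state whose fidelity with `Ψ_m` is at least `1 - ε`. -/
def Distillable {a b : Type*} [Fintype a] [Fintype b] [DecidableEq a] [DecidableEq b]
    (δ : ℝ) (m : ℕ) (ρ : Matrix (a × b) (a × b) ℂ) (ε : ℝ≥0) : Prop :=
  ∃ (k : ℕ) (E : Fin k → (Matrix (a × b) (a × b) ℂ →ₗ[ℂ]
      Matrix (Fin m × Fin m) (Fin m × Fin m) ℂ)) (i : Fin k),
    IsApproxDNE δ E ∧ (E i ρ).trace ≠ 0 ∧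
      1 - (ε : ℝ) ≤ fidelity ((E i ρ).trace⁻¹ • E i ρ) (maxEnt m)

/-- The probabilistic distillation error exponent `E_{d,err,p}^{(m),DNE_δ}(ρ)`: the supremum of
`lim_n -(1/n) log₂ ε_n` over all sequences of errors that are attained for `ρ^{⊗ n}`, `n ≥ 1`. -/
def distillExponent {a b : Type*} [Fintype a] [Fintype b] [DecidableEq a] [DecidableEq b]
    (δ : ℝ) (m : ℕ) (ρ : Matrix (a × b) (a × b) ℂ) : EReal :=
  sSup {r : EReal | ∃ ε : ℕ → ℝ≥0,
    (∀ n, 1 ≤ n → Distillable δ m (tensorPow n ρ) (ε n)) ∧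
    Filter.Tendsto (fun n : ℕ => -log2 (ε n : ℝ≥0∞) / ((n : ℝ) : EReal))
      Filter.atTop (nhds r)}

/-! ### Separable measurements and the regularized quantity -/

/-- A separable measurement: a finite POVM all of whose elements lie in the separable cone. -/
def IsSepPOVM {a b : Type*} [Fintype a] [Fintype b] [DecidableEq a] [DecidableEq b] {k : ℕ}
    (M : Fin k → Matrix (a × b) (a × b) ℂ) : Prop :=
  (∀ i, InSepCone (M i)) ∧ ∑ i, M i = 1

/-- The measurement channel `X ↦ ∑ᵢ tr (Mᵢ X) |i⟩⟨i|`. -/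
def measure {ι : Type*} [Fintype ι] {k : ℕ} (M : Fin k → Matrix ι ι ℂ) (X : Matrix ι ι ℂ) :
    Matrix (Fin k) (Fin k) ℂ :=
  Matrix.diagonal fun i => (M i * X).trace

/-- `Ω_SEP(σ, ρ) = sup_{M ∈ SEP} Ω(M(σ), M(ρ))`. -/
def omegaSEP {a b : Type*} [Fintype a] [Fintype b] [DecidableEq a] [DecidableEq b]
    (σ ρ : Matrix (a × b) (a × b) ℂ) : ℝ≥0∞ :=
  ⨆ (k : ℕ) (M : Fin k → Matrix (a × b) (a × b) ℂ) (_ : IsSepPOVM M),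
    hilbertOmega (measure M σ) (measure M ρ)

/-- `Ω̂_Sep^SEP(ρ) = inf_{σ ∈ Sep} Ω_SEP(σ, ρ)`. -/
def omegaHatSEP {a b : Type*} [Fintype a] [Fintype b] [DecidableEq a] [DecidableEq b]
    (ρ : Matrix (a × b) (a × b) ℂ) : ℝ≥0∞ :=
  ⨅ (σ : Matrix (a × b) (a × b) ℂ) (_ : IsSep σ), omegaSEP σ ρ

/-- The sequence `(1/n) log₂ Ω̂_Sep^SEP(ρ^{⊗ n})`. -/
def dHatSEPSeq {a b : Type*} [Fintype a] [Fintype b] [DecidableEq a] [DecidableEq b]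
    (ρ : Matrix (a × b) (a × b) ℂ) (n : ℕ) : EReal :=
  log2 (omegaHatSEP (tensorPow n ρ)) / ((n : ℝ) : EReal)

/-- `D̂_{Ω,Sep}^{reg,SEP}(ρ) = lim_n (1/n) log₂ Ω̂_Sep^SEP(ρ^{⊗ n})`. -/
def dHatSEPReg {a b : Type*} [Fintype a] [Fintype b] [DecidableEq a] [DecidableEq b]
    (ρ : Matrix (a × b) (a × b) ℂ) : EReal :=
  Filter.limUnder Filter.atTop (dHatSEPSeq ρ)

end Distill

end

/-!
The exponent is computed by a single-copy quantity up to constants that do not depend on the number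
of copies.

*Duality.* By conic duality, `Ω̂_Sep^SEP(ρ)` is the supremum of the `t` for which there are
separable operators `E`, `F` with `tr (E σ) ≤ tr (F σ)` for all separable `σ`, but
`tr (E ρ) ≥ t tr (F ρ)` and `tr (E ρ) > 0` (`HasRatioTest t ρ`). That such a pair bounds `Ω̂` from
below (`HasRatioTest.le_omegaHatSEP`) uses that a separable operator of trace at most one is an
effect of a separable measurement. The converse (`hasRatioTest_of_lt_omegaHatSEP`) is Sion's minimax
theorem, together with the compactness of the set of separable states.

*Existence of the limit.* Tensor products of such pairs are such pairs, because pairing one half of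
a separable state with a separable effect leaves a separable operator on the other half
(`HasRatioTest.bipartiteTensor`). Hence `log Ω̂_Sep^SEP(ρ^{⊗ n})` is superadditive, and Fekete's
lemma applies (`tendsto_dHatSEPSeq`).

*Achievability.* The measure-and-prepare map
`X ↦ tr (E X) Ψ_m + tr (F X) (1 - Ψ_m) / (m + 1)` sends separable states to separable isotropic
operators and is dually nonentangling since `E`, `F` are separable. It distils `Ψ_m` from `ρ` with
error `(m - 1) / t` (`distillable_of_hasRatioTest`).

*Converse.* The isotropic operators `1 + m Ψ_m` and `1 - Ψ_m` are separable. A dually nonentangling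
map pulls them back to separable operators, and since it is approximately nonentangling, these form,
up to a constant, a pair as above whose value `t` is of the order of the inverse error
(`Distillable.hasRatioTest`).
-/

open scoped NNReal ENNReal MatrixOrder ComplexOrder Kronecker

noncomputable section

namespace Distill

/-! ### Convex hulls of compact sets -/

/-- By Carathéodory's theorem, the convex hull of a compact set in a finite-dimensional space is a
continuous image of a product of a simplex with finitely many copies of the set. -/
theorem isCompact_convexHull {V : Type*} [AddCommGroup V] [Module ℝ V] [TopologicalSpace V]
    [IsTopologicalAddGroup V] [ContinuousSMul ℝ V] [FiniteDimensional ℝ V] {s : Set V}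
    (hs : IsCompact s) : IsCompact (convexHull ℝ s) := by
  classical
  rcases s.eq_empty_or_nonempty with rfl | ⟨s₀, hs₀⟩
  · simp
  set N := Module.finrank ℝ V + 1
  have hK : IsCompact ((stdSimplex ℝ (Fin N)) ×ˢ (Set.univ.pi fun _ : Fin N => s)) :=
    (isCompact_stdSimplex ℝ (Fin N)).prod (isCompact_univ_pi fun _ => hs)
  have hcont : Continuous fun p : (Fin N → ℝ) × (Fin N → V) => ∑ i, p.1 i • p.2 i := by fun_prop
  convert hK.image hcont using 1
  ext x
  constructor
  · intro hx
    obtain ⟨ι, _, z, w, hz, hind, hw, hw1, rfl⟩ := eq_pos_convex_span_of_mem_convexHull hx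
    have hcard : Fintype.card ι ≤ Fintype.card (Fin N) := by
      rw [Fintype.card_fin]
      exact hind.card_le_finrank_succ.trans (Nat.add_le_add_right (Submodule.finrank_le _) 1)
    obtain ⟨e⟩ := Function.Embedding.nonempty_of_card_le hcard
    have hext : ∀ i, e i ∈ Set.range e := fun i => ⟨i, rfl⟩
    have hzero : ∀ j, j ∉ Set.range e → Function.extend e w 0 j = 0 := fun j hj =>
      Function.extend_apply' _ _ _ hj
    refine ⟨(Function.extend e w 0, Function.extend e z fun _ => s₀), ⟨⟨fun j => ?_, ?_⟩, ?_⟩, ?_⟩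
    · by_cases hj : j ∈ Set.range e
      · obtain ⟨i, rfl⟩ := hj
        simpa [e.injective.extend_apply] using (hw i).le
      · exact (hzero j hj).ge
    · rw [← hw1]
      symm
      refine Fintype.sum_of_injective e e.injective _ _ hzero fun i => ?_
      simp [e.injective.extend_apply]
    · intro j _
      by_cases hj : j ∈ Set.range e
      · obtain ⟨i, rfl⟩ := hj
        simpa [e.injective.extend_apply] using hz ⟨i, rfl⟩
      · simpa [Function.extend_apply' _ _ _ hj] using hs₀
    · symm
      refine Fintype.sum_of_injective e e.injective _ _ (fun j hj => ?_) fun i => ?_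
      · simp only [hzero j hj, zero_smul]
      · simp [e.injective.extend_apply]
  · rintro ⟨⟨w, z⟩, ⟨hw, hz⟩, rfl⟩
    exact mem_convexHull_of_exists_fintype w z hw.1 hw.2 (fun i => hz i trivial) rfl

/-! ### Positive semidefinite matrices -/

theorem re_trace_nonneg {ι : Type*} [Fintype ι] {X : Matrix ι ι ℂ} (hX : X.PosSemidef) :
    0 ≤ X.trace.re := (Complex.nonneg_iff.1 hX.trace_nonneg).1

theorem exists_eq_conjTranspose_mul {ι : Type*} [Fintype ι] {X : Matrix ι ι ℂ}
    (hX : X.PosSemidef) : ∃ B : Matrix ι ι ℂ, X = B.conjTranspose * B := by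
  classical
  exact CStarAlgebra.nonneg_iff_eq_star_mul_self.mp hX.nonneg

theorem trace_mul_nonneg {ι : Type*} [Fintype ι] {X Y : Matrix ι ι ℂ} (hX : X.PosSemidef)
    (hY : Y.PosSemidef) : 0 ≤ (X * Y).trace := by
  obtain ⟨B, rfl⟩ := exists_eq_conjTranspose_mul hX
  rw [Matrix.mul_assoc, Matrix.trace_mul_comm]
  exact (hY.mul_mul_conjTranspose_same B).trace_nonneg

theorem re_trace_mul_nonneg {ι : Type*} [Fintype ι] {X Y : Matrix ι ι ℂ} (hX : X.PosSemidef)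
    (hY : Y.PosSemidef) : 0 ≤ (X * Y).trace.re := (Complex.nonneg_iff.1 (trace_mul_nonneg hX hY)).1

theorem trace_mul_eq_ofReal {ι : Type*} [Fintype ι] {X Y : Matrix ι ι ℂ} (hX : X.PosSemidef)
    (hY : Y.PosSemidef) : (X * Y).trace = ((X * Y).trace.re : ℂ) :=
  Complex.eq_re_of_ofReal_le (r := 0) (by simpa using trace_mul_nonneg hX hY)

theorem trace_eq_ofReal {ι : Type*} [Fintype ι] {X : Matrix ι ι ℂ} (hX : X.PosSemidef) :
    X.trace = (X.trace.re : ℂ) :=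
  Complex.eq_re_of_ofReal_le (r := 0) (by simpa using hX.trace_nonneg)

theorem posSemidef_smul {ι : Type*} [Fintype ι] {X : Matrix ι ι ℂ} (hX : X.PosSemidef) {t : ℝ}
    (ht : 0 ≤ t) : (t • X).PosSemidef := hX.smul ht

theorem posSemidef_of_mul_self_eq_smul {ι : Type*} [Fintype ι] {X : Matrix ι ι ℂ}
    (hX : X.IsHermitian) {t : ℝ} (ht : 0 < t) (h : X * X = t • X) : X.PosSemidef := by
  have h1 : (X.conjTranspose * X).PosSemidef := Matrix.posSemidef_conjTranspose_mul_self X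
  rw [hX.eq, h] at h1
  simpa [smul_smul, inv_mul_cancel₀ ht.ne'] using posSemidef_smul h1 (inv_nonneg.2 ht.le)

/-- A rank-one positive matrix is dominated by its trace: `c - |v⟩⟨v|` is `c` times a projection,
where `c = ⟨v, v⟩`. -/
theorem posSemidef_smul_one_sub_vecMulVec {ι : Type*} [Fintype ι] [DecidableEq ι] (v : ι → ℂ)
    {c : ℝ} (hc : star v ⬝ᵥ v = (c : ℂ)) :
    (c • (1 : Matrix ι ι ℂ) - Matrix.vecMulVec v (star v)).PosSemidef := by
  rcases eq_or_ne v 0 with rfl | hv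
  · have : c = 0 := by simpa using hc.symm
    simp [this, Matrix.PosSemidef.zero]
  have hc0 : 0 < c := by
    have := Matrix.dotProduct_star_self_pos_iff.2 hv
    rw [hc] at this
    exact_mod_cast this
  refine posSemidef_of_mul_self_eq_smul ?_ hc0 ?_
  · rw [Matrix.IsHermitian, Matrix.conjTranspose_sub, Matrix.conjTranspose_smul,
      Matrix.conjTranspose_vecMulVec]
    simp
  · have h1 : Matrix.vecMulVec v (star v) * Matrix.vecMulVec v (star v) =
        c • Matrix.vecMulVec v (star v) := by
      rw [Matrix.vecMulVec_mul_vecMulVec, hc]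
      ext i j
      simp [Matrix.vecMulVec_apply]
      ring
    simp only [sub_mul, mul_sub, h1, smul_mul_assoc, mul_smul_comm, one_mul, mul_one, smul_sub]
    abel

/-- A positive semidefinite matrix is dominated by its trace. -/
theorem posSemidef_trace_smul_one_sub {ι : Type*} [Fintype ι] [DecidableEq ι] {X : Matrix ι ι ℂ}
    (hX : X.PosSemidef) : (X.trace.re • (1 : Matrix ι ι ℂ) - X).PosSemidef := by
  obtain ⟨k, v, rfl⟩ := Matrix.posSemidef_iff_eq_sum_vecMulVec.1 hX
  have h : ∀ i, star (v i) ⬝ᵥ v i = ((Matrix.vecMulVec (v i) (star (v i))).trace.re : ℂ) := by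
    intro i
    rw [← trace_eq_ofReal (Matrix.posSemidef_vecMulVec_self_star _), Matrix.trace_vecMulVec,
      dotProduct_comm]
  rw [Matrix.trace_sum, Complex.re_sum, Finset.sum_smul, ← Finset.sum_sub_distrib]
  exact Matrix.posSemidef_sum _ fun i _ => posSemidef_smul_one_sub_vecMulVec _ (h i)

/-- The state space is the image of the unit sphere of the Frobenius norm under `B ↦ B† B`. -/
theorem isCompact_states {ι : Type*} [Fintype ι] : IsCompact {ρ : Matrix ι ι ℂ | IsState ρ} := by
  have hB : IsCompact {B : ι → ι → ℂ | ∑ i, ∑ j, ‖B i j‖ ^ 2 = 1} := by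
    refine Metric.isCompact_of_isClosed_isBounded
      (isClosed_eq (by fun_prop) continuous_const) ?_
    refine (Metric.isBounded_closedBall (x := 0) (r := 1)).subset fun B hB => ?_
    rw [mem_closedBall_zero_iff, pi_norm_le_iff_of_nonneg zero_le_one]
    intro i
    rw [pi_norm_le_iff_of_nonneg zero_le_one]
    intro j
    have h1 : ‖B i j‖ ^ 2 ≤ ∑ j, ‖B i j‖ ^ 2 :=
      Finset.single_le_sum (f := fun j => ‖B i j‖ ^ 2) (fun _ _ => by positivity)
        (Finset.mem_univ j)
    have h2 : ∑ j, ‖B i j‖ ^ 2 ≤ ∑ i, ∑ j, ‖B i j‖ ^ 2 :=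
      Finset.single_le_sum (f := fun i => ∑ j, ‖B i j‖ ^ 2) (fun _ _ => by positivity)
        (Finset.mem_univ i)
    have h3 : ∑ i, ∑ j, ‖B i j‖ ^ 2 = 1 := hB
    nlinarith [norm_nonneg (B i j)]
  have hf : Continuous fun B : Matrix ι ι ℂ => B.conjTranspose * B := by fun_prop
  have htr : ∀ B : Matrix ι ι ℂ,
      (B.conjTranspose * B).trace = ((∑ i, ∑ j, ‖B i j‖ ^ 2 : ℝ) : ℂ) := by
    intro B
    simp only [Matrix.trace, Matrix.diag_apply, Matrix.mul_apply, Matrix.conjTranspose_apply]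
    rw [Finset.sum_comm]
    push_cast
    refine Finset.sum_congr rfl fun i _ => Finset.sum_congr rfl fun j _ => ?_
    rw [RCLike.star_def, Complex.conj_mul']
  convert hB.image hf using 1
  ext ρ
  constructor
  · rintro ⟨h1, h2⟩
    obtain ⟨B, rfl⟩ := exists_eq_conjTranspose_mul h1
    refine ⟨B, ?_, rfl⟩
    rw [htr] at h2
    exact_mod_cast h2
  · rintro ⟨B, h1, rfl⟩
    refine ⟨Matrix.posSemidef_conjTranspose_mul_self _, ?_⟩
    rw [htr B]
    exact_mod_cast h1

/-! ### The separable cone -/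

section SepCone

variable {a b : Type*} [Fintype a] [Fintype b]

/-- Product states of a bipartite system. -/
def productStates (a b : Type*) [Fintype a] [Fintype b] : Set (Matrix (a × b) (a × b) ℂ) :=
  {X | ∃ α β, IsState α ∧ IsState β ∧ X = α ⊗ₖ β}

theorem isSep_iff_mem_convexHull {σ : Matrix (a × b) (a × b) ℂ} :
    IsSep σ ↔ σ ∈ convexHull ℝ (productStates a b) := by
  constructor
  · rintro ⟨k, p, α, β, hp, hp1, hα, hβ, rfl⟩
    exact mem_convexHull_of_exists_fintype p _ hp hp1 (fun i => ⟨α i, β i, hα i, hβ i, rfl⟩) rfl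
  · intro h
    obtain ⟨ι, _, w, z, hw, hw1, hz, rfl⟩ := mem_convexHull_iff_exists_fintype.1 h
    choose α β hα hβ hz using hz
    let e := (Fintype.equivFin ι).symm
    refine ⟨Fintype.card ι, w ∘ e, α ∘ e, β ∘ e, fun i => hw _, ?_, fun i => hα _, fun i => hβ _,
      ?_⟩
    · rw [← hw1]
      exact e.sum_comp w
    · rw [← e.sum_comp]
      simp [hz]

theorem isCompact_productStates : IsCompact (productStates a b) := by
  have h := (isCompact_states (ι := a)).prod (isCompact_states (ι := b))
  have hf : Continuous fun p : Matrix a a ℂ × Matrix b b ℂ => p.1 ⊗ₖ p.2 := by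
    refine continuous_matrix fun i j => ?_
    simp only [Matrix.kroneckerMap_apply]
    fun_prop
  convert h.image hf using 1
  ext X
  constructor
  · rintro ⟨α, β, hα, hβ, rfl⟩
    exact ⟨(α, β), ⟨hα, hβ⟩, rfl⟩
  · rintro ⟨⟨α, β⟩, ⟨hα, hβ⟩, rfl⟩
    exact ⟨α, β, hα, hβ, rfl⟩

theorem IsState.kronecker {α : Matrix a a ℂ} {β : Matrix b b ℂ} (hα : IsState α)
    (hβ : IsState β) : IsState (α ⊗ₖ β) :=
  ⟨hα.1.kronecker hβ.1, by rw [Matrix.trace_kronecker, hα.2, hβ.2, one_mul]⟩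

theorem IsSep.of_product {α : Matrix a a ℂ} {β : Matrix b b ℂ} (hα : IsState α)
    (hβ : IsState β) : IsSep (α ⊗ₖ β) :=
  isSep_iff_mem_convexHull.2 (subset_convexHull _ _ ⟨α, β, hα, hβ, rfl⟩)

theorem IsSep.isState {σ : Matrix (a × b) (a × b) ℂ} (h : IsSep σ) : IsState σ := by
  obtain ⟨k, p, α, β, hp, hp1, hα, hβ, rfl⟩ := h
  refine ⟨Matrix.posSemidef_sum _ fun i _ => posSemidef_smul ((hα i).kronecker (hβ i)).1 (hp i), ?_⟩
  rw [Matrix.trace_sum]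
  simp only [Matrix.trace_smul, ((hα _).kronecker (hβ _)).2]
  rw [← Finset.sum_smul, hp1, one_smul]

theorem IsSep.inSepCone {σ : Matrix (a × b) (a × b) ℂ} (h : IsSep σ) : InSepCone σ :=
  ⟨1, σ, zero_le_one, h, (one_smul _ _).symm⟩

theorem InSepCone.posSemidef {X : Matrix (a × b) (a × b) ℂ} (h : InSepCone X) : X.PosSemidef := by
  obtain ⟨t, σ, ht, hσ, rfl⟩ := h
  exact posSemidef_smul hσ.isState.1 ht

theorem InSepCone.smul {X : Matrix (a × b) (a × b) ℂ} (h : InSepCone X) {s : ℝ} (hs : 0 ≤ s) :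
    InSepCone (s • X) := by
  obtain ⟨t, σ, ht, hσ, rfl⟩ := h
  exact ⟨s * t, σ, mul_nonneg hs ht, hσ, smul_smul _ _ _⟩

theorem InSepCone.add {X Y : Matrix (a × b) (a × b) ℂ} (hX : InSepCone X) (hY : InSepCone Y) :
    InSepCone (X + Y) := by
  obtain ⟨t, σ, ht, hσ, rfl⟩ := hX
  obtain ⟨s, τ, hs, hτ, rfl⟩ := hY
  rcases (add_nonneg ht hs).eq_or_lt with h | h
  · have h1 : t = 0 := by linarith
    have h2 : s = 0 := by linarith
    exact ⟨0, σ, le_rfl, hσ, by simp [h1, h2]⟩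
  · refine ⟨t + s, (t / (t + s)) • σ + (s / (t + s)) • τ, h.le, ?_, ?_⟩
    · rw [isSep_iff_mem_convexHull] at *
      refine convex_convexHull ℝ _ hσ hτ (by positivity) (by positivity) ?_
      field_simp
    · rw [smul_add, smul_smul, smul_smul, mul_div_cancel₀ _ h.ne', mul_div_cancel₀ _ h.ne']

theorem IsState.nonempty {ι : Type*} [Fintype ι] {ρ : Matrix ι ι ℂ} (h : IsState ρ) :
    Nonempty ι := by
  by_contra hne
  rw [not_nonempty_iff] at hne
  have := h.2
  simp [Matrix.trace] at this

theorem IsState.of_posSemidef {ι : Type*} [Fintype ι] {X : Matrix ι ι ℂ} (h : X.PosSemidef)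
    (h0 : X ≠ 0) : IsState (X.trace.re⁻¹ • X) ∧ 0 < X.trace.re := by
  have h1 : X.trace.re ≠ 0 := fun h2 => h0 <| by
    rw [← h.trace_eq_zero_iff, trace_eq_ofReal h, h2, Complex.ofReal_zero]
  refine ⟨⟨posSemidef_smul h (inv_nonneg.2 (re_trace_nonneg h)), ?_⟩,
    (re_trace_nonneg h).lt_of_ne' h1⟩
  have h2 := trace_eq_ofReal h
  rw [Matrix.trace_smul, h2]
  simp [h1]

theorem exists_isState (ι : Type*) [Fintype ι] [Nonempty ι] : ∃ α : Matrix ι ι ℂ, IsState α := by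
  classical
  have h : (1 : Matrix ι ι ℂ) ≠ 0 := one_ne_zero
  exact ⟨_, (IsState.of_posSemidef Matrix.PosSemidef.one h).1⟩

theorem exists_isSep (a b : Type*) [Fintype a] [Fintype b] [Nonempty a] [Nonempty b] :
    ∃ σ : Matrix (a × b) (a × b) ℂ, IsSep σ := by
  obtain ⟨α, hα⟩ := exists_isState a
  obtain ⟨β, hβ⟩ := exists_isState b
  exact ⟨_, IsSep.of_product hα hβ⟩

theorem InSepCone.zero [Nonempty a] [Nonempty b] :
    InSepCone (0 : Matrix (a × b) (a × b) ℂ) := by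
  obtain ⟨σ, hσ⟩ := exists_isSep a b
  exact ⟨0, σ, le_rfl, hσ, (zero_smul _ _).symm⟩

theorem InSepCone.sum [Nonempty a] [Nonempty b] {ι : Type*} (s : Finset ι)
    {X : ι → Matrix (a × b) (a × b) ℂ} (h : ∀ i ∈ s, InSepCone (X i)) :
    InSepCone (∑ i ∈ s, X i) :=
  Finset.sum_induction _ _ (fun _ _ => InSepCone.add) InSepCone.zero h

theorem InSepCone.kronecker [Nonempty a] [Nonempty b] {P : Matrix a a ℂ} {Q : Matrix b b ℂ}
    (hP : P.PosSemidef) (hQ : Q.PosSemidef) : InSepCone (P ⊗ₖ Q) := by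
  rcases eq_or_ne P 0 with rfl | hP0
  · simpa using InSepCone.zero
  rcases eq_or_ne Q 0 with rfl | hQ0
  · simpa using InSepCone.zero
  obtain ⟨h1, h2⟩ := IsState.of_posSemidef hP hP0
  obtain ⟨h3, h4⟩ := IsState.of_posSemidef hQ hQ0
  have h5 := (IsSep.of_product h1 h3).inSepCone.smul (mul_pos h2 h4).le
  rw [Matrix.smul_kronecker, Matrix.kronecker_smul, smul_smul, smul_smul] at h5
  convert h5
  rw [mul_assoc, ← mul_inv, mul_inv_cancel₀ (mul_pos h2 h4).ne', one_smul]

/-- The separable cone is generated by tensor products of positive operators. -/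
theorem InSepCone.induction {p : Matrix (a × b) (a × b) ℂ → Prop} (h0 : p 0)
    (hadd : ∀ X Y, p X → p Y → p (X + Y))
    (hk : ∀ P Q, P.PosSemidef → Q.PosSemidef → p (P ⊗ₖ Q)) {X : Matrix (a × b) (a × b) ℂ}
    (hX : InSepCone X) : p X := by
  obtain ⟨t, σ, ht, ⟨k, w, α, β, hw, hw1, hα, hβ, rfl⟩, rfl⟩ := hX
  rw [Finset.smul_sum]
  refine Finset.sum_induction _ p hadd h0 fun i _ => ?_
  rw [smul_smul, ← Matrix.smul_kronecker]
  exact hk _ _ (posSemidef_smul (hα i).1 (mul_nonneg ht (hw i))) (hβ i).1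

theorem InSepCone.one [Nonempty a] [Nonempty b] [DecidableEq a] [DecidableEq b] :
    InSepCone (1 : Matrix (a × b) (a × b) ℂ) := by
  rw [← Matrix.one_kronecker_one]
  exact InSepCone.kronecker Matrix.PosSemidef.one Matrix.PosSemidef.one

/-- Separable operators of trace at most one are effects whose complement is separable too, by
`1 - α ⊗ β = (1 - α) ⊗ 1 + α ⊗ (1 - β)` for product states. -/
theorem InSepCone.one_sub [DecidableEq a] [DecidableEq b] {X : Matrix (a × b) (a × b) ℂ}
    (hX : InSepCone X) (hX1 : X.trace.re ≤ 1) : InSepCone (1 - X) := by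
  obtain ⟨t, σ, ht, hσ, rfl⟩ := hX
  have := hσ.isState.nonempty
  have : Nonempty a := (nonempty_prod.1 this).1
  have : Nonempty b := (nonempty_prod.1 ‹Nonempty (a × b)›).2
  rw [Matrix.trace_smul, hσ.isState.2] at hX1
  have ht1 : t ≤ 1 := by simpa using hX1
  have key : InSepCone (1 - σ) := by
    obtain ⟨k, w, α, β, hw, hw1, hα, hβ, rfl⟩ := hσ
    have h1 : (1 : Matrix (a × b) (a × b) ℂ) = ∑ i, w i • (1 : Matrix (a × b) (a × b) ℂ) := by
      rw [← Finset.sum_smul, hw1, one_smul]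
    rw [h1, ← Finset.sum_sub_distrib]
    refine InSepCone.sum _ fun i _ => ?_
    have h2 : (1 : Matrix (a × b) (a × b) ℂ) - α i ⊗ₖ β i =
        (1 - α i) ⊗ₖ (1 : Matrix b b ℂ) + α i ⊗ₖ (1 - β i) := by
      rw [← Matrix.one_kronecker_one]
      ext x y
      simp only [Matrix.kroneckerMap_apply, Matrix.sub_apply, Matrix.add_apply]
      ring
    have h3 := posSemidef_trace_smul_one_sub (hα i).1
    have h4 := posSemidef_trace_smul_one_sub (hβ i).1
    rw [(hα i).2, Complex.one_re, one_smul] at h3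
    rw [(hβ i).2, Complex.one_re, one_smul] at h4
    rw [← smul_sub, h2]
    exact ((InSepCone.kronecker h3 Matrix.PosSemidef.one).add
      (InSepCone.kronecker (hα i).1 h4)).smul (hw i)
  have h : (1 : Matrix (a × b) (a × b) ℂ) - t • σ = (1 - t) • 1 + t • (1 - σ) := by
    rw [smul_sub, sub_smul, one_smul]
    abel
  rw [h]
  exact (InSepCone.one.smul (sub_nonneg.2 ht1)).add (key.smul ht)

theorem InSepCone.isSubSep {X : Matrix (a × b) (a × b) ℂ} (hX : InSepCone X)
    (hX1 : X.trace.re ≤ 1) : IsSubSep X := by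
  obtain ⟨t, σ, ht, hσ, rfl⟩ := hX
  rw [Matrix.trace_smul, hσ.isState.2] at hX1
  exact ⟨t, σ, ht, by simpa using hX1, hσ, rfl⟩

theorem IsSubSep.inSepCone {X : Matrix (a × b) (a × b) ℂ} (hX : IsSubSep X) : InSepCone X := by
  obtain ⟨t, σ, ht, -, hσ, rfl⟩ := hX
  exact ⟨t, σ, ht, hσ, rfl⟩

end SepCone

/-! ### Ratio tests and the single-copy duality -/

section RatioTest

variable {a b : Type*} [Fintype a] [Fintype b]

/-- A pair of separable operators `E`, `F` with `tr (E σ) ≤ tr (F σ)` on all separable states, but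
`tr (E ρ) ≥ t tr (F ρ)` and `tr (E ρ) > 0`: a feasible point of value `t` of the cone program dual
to the one that computes `Ω̂_Sep^SEP(ρ)`. -/
def HasRatioTest (t : ℝ) (ρ : Matrix (a × b) (a × b) ℂ) : Prop :=
  ∃ E F : Matrix (a × b) (a × b) ℂ, InSepCone E ∧ InSepCone F ∧
    (∀ σ, IsSep σ → (E * σ).trace.re ≤ (F * σ).trace.re) ∧
    0 < (E * ρ).trace.re ∧ t * (F * ρ).trace.re ≤ (E * ρ).trace.re

theorem trace_measure [DecidableEq a] [DecidableEq b] {k : ℕ}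
    {M : Fin k → Matrix (a × b) (a × b) ℂ} (hM : IsSepPOVM M) (X : Matrix (a × b) (a × b) ℂ) :
    (measure M X).trace = X.trace := by
  rw [measure, Matrix.trace_diagonal, ← Matrix.trace_sum, ← Finset.sum_mul, hM.2, one_mul]

/-- Weak duality: the separable measurement with effects proportional to `E`, `F` already
distinguishes every separable state from `ρ` with Hilbert ratio at least `t`. -/
theorem HasRatioTest.le_omegaHatSEP [DecidableEq a] [DecidableEq b] {t : ℝ}
    {ρ : Matrix (a × b) (a × b) ℂ} (h : HasRatioTest t ρ) (hρ : IsState ρ) :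
    ENNReal.ofReal t ≤ omegaHatSEP ρ := by
  obtain ⟨E, F, hE, hF, hσ', hpos, hle⟩ := h
  refine le_iInf₂ fun σ hσ => ?_
  set c : ℝ := (1 + (E + F).trace.re)⁻¹ with hc
  have hEF := re_trace_nonneg (hE.add hF).posSemidef
  have hc0 : 0 < c := by positivity
  have hM : IsSepPOVM ![c • E, c • F, 1 - c • (E + F)] := by
    refine ⟨fun i => ?_, ?_⟩
    · fin_cases i
      · exact hE.smul hc0.le
      · exact hF.smul hc0.le
      · refine ((hE.add hF).smul hc0.le).one_sub ?_
        rw [Matrix.trace_smul, Complex.smul_re, smul_eq_mul, hc, inv_mul_le_iff₀ (by positivity)]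
        linarith
    · rw [Fin.sum_univ_three]
      simp [smul_add]
  refine le_trans ?_ (le_iSup_of_le 3 (le_iSup_of_le _ (le_iSup_of_le hM le_rfl)))
  refine le_iInf₂ fun γ hγ => ?_
  obtain ⟨-, η, h1, h2⟩ := hγ
  have hη : (1 : ℝ) ≤ η := by
    have := re_trace_nonneg h1
    rw [Matrix.trace_sub, Matrix.trace_smul, trace_measure hM, trace_measure hM, hρ.2,
      hσ.isState.2] at this
    simpa using this
  have h4 := (Complex.nonneg_iff.1 (h2.diag_nonneg (i := 0))).1
  simp [measure, Matrix.trace_smul] at h4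
  have h6 := hσ' σ hσ
  have h7 : (η : ℝ) * (E * ρ).trace.re ≤ γ * (E * σ).trace.re := by
    refine le_of_mul_le_mul_left ?_ hc0
    linarith
  have h9 := (Complex.nonneg_iff.1 (h1.diag_nonneg (i := 1))).1
  simp [measure, Matrix.trace_smul] at h9
  have h10 : (F * σ).trace.re ≤ η * (F * ρ).trace.re := by
    refine le_of_mul_le_mul_left ?_ hc0
    linarith
  have h11 : (η : ℝ) * (E * ρ).trace.re ≤ η * (γ * (F * ρ).trace.re) := by
    calc (η : ℝ) * (E * ρ).trace.re ≤ γ * (E * σ).trace.re := h7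
      _ ≤ γ * (η * (F * ρ).trace.re) := by gcongr; linarith
      _ = _ := by ring
  have h12 : (E * ρ).trace.re ≤ γ * (F * ρ).trace.re := le_of_mul_le_mul_left h11 (by linarith)
  have h13 := re_trace_mul_nonneg hF.posSemidef hρ.1
  have h14 : 0 < (F * ρ).trace.re := h13.lt_of_ne' fun h0 => by
    rw [h0, mul_zero] at h12
    linarith
  have h15 : t ≤ γ := le_of_mul_le_mul_right (hle.trans h12) h14
  exact ENNReal.ofReal_le_of_le_toReal (by simpa using h15)

/-- If `s σ` lies between `ρ` and `t ρ` in the order dual to the separable cone, then no separable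
measurement distinguishes `σ` from `ρ` with Hilbert ratio above `t`. -/
theorem omegaSEP_le [DecidableEq a] [DecidableEq b] {t s : ℝ} {ρ σ : Matrix (a × b) (a × b) ℂ}
    (hρ : IsState ρ) (hσ : IsSep σ) (hs : 0 < s) (ht : 0 < t)
    (h1 : ∀ E, InSepCone E → (E * ρ).trace.re ≤ s * (E * σ).trace.re)
    (h2 : ∀ E, InSepCone E → s * (E * σ).trace.re ≤ t * (E * ρ).trace.re) :
    omegaSEP σ ρ ≤ ENNReal.ofReal t := by
  refine iSup_le fun k => iSup_le fun M => iSup_le fun hM => ?_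
  have hp : ∀ i, 0 ≤ (M i * σ).trace.re := fun i =>
    re_trace_mul_nonneg (hM.1 i).posSemidef hσ.isState.1
  have hq : ∀ i, 0 ≤ (M i * ρ).trace.re := fun i =>
    re_trace_mul_nonneg (hM.1 i).posSemidef hρ.1
  have eσ : measure M σ = Matrix.diagonal fun i => ((M i * σ).trace.re : ℂ) :=
    congrArg _ (funext fun i => trace_mul_eq_ofReal (hM.1 i).posSemidef hσ.isState.1)
  have eρ : measure M ρ = Matrix.diagonal fun i => ((M i * ρ).trace.re : ℂ) :=
    congrArg _ (funext fun i => trace_mul_eq_ofReal (hM.1 i).posSemidef hρ.1)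
  have hts : 0 ≤ t / s := by positivity
  refine iInf₂_le_of_le ⟨t, ht.le⟩ ⟨?_, ⟨t / s, hts⟩, ?_, ?_⟩
    (by rw [ENNReal.ofReal, Real.toNNReal_of_nonneg ht.le]; exact le_rfl)
  · intro v
    have h0 : ∀ i, (M i * σ).trace.re = 0 ↔ (M i * ρ).trace.re = 0 := by
      intro i
      have h3 := h1 _ (hM.1 i)
      have h4 := h2 _ (hM.1 i)
      constructor
      · intro h
        rw [h, mul_zero] at h3
        exact le_antisymm h3 (hq i)
      · intro h
        rw [h, mul_zero] at h4
        exact le_antisymm (nonpos_of_mul_nonpos_right h4 hs) (hp i)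
    simp only [eσ, eρ, funext_iff, Matrix.mulVec_diagonal, Pi.zero_apply, mul_eq_zero,
      Complex.ofReal_eq_zero, h0]
  · rw [eσ, eρ, ← Matrix.diagonal_smul, Matrix.diagonal_sub, Matrix.posSemidef_diagonal_iff]
    intro i
    have h4 := h2 _ (hM.1 i)
    have : 0 ≤ t / s * (M i * ρ).trace.re - (M i * σ).trace.re := by
      rw [div_mul_eq_mul_div, sub_nonneg, le_div_iff₀ hs]
      linarith
    simp only [Pi.smul_apply, Complex.real_smul]
    exact_mod_cast this
  · rw [eσ, eρ, ← Matrix.diagonal_smul, ← Matrix.diagonal_smul, Matrix.diagonal_sub,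
      Matrix.posSemidef_diagonal_iff]
    intro i
    have h4 := h1 _ (hM.1 i)
    have : 0 ≤ t * (M i * σ).trace.re - t / s * (M i * ρ).trace.re := by
      rw [div_mul_eq_mul_div, sub_nonneg, div_le_iff₀ hs, mul_assoc]
      exact mul_le_mul_of_nonneg_left (by linarith) ht.le
    simp only [Pi.smul_apply, Complex.real_smul]
    exact_mod_cast this

theorem InSepCone.re_trace_mul_nonneg_of_product {E X : Matrix (a × b) (a × b) ℂ}
    (hE : InSepCone E) (h : ∀ E ∈ productStates a b, 0 ≤ (E * X).trace.re) :
    0 ≤ (E * X).trace.re := by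
  obtain ⟨t, σ, ht, ⟨k, p, α, β, hp, hp1, hα, hβ, rfl⟩, rfl⟩ := hE
  rw [Matrix.smul_mul, Matrix.trace_smul, Complex.smul_re, Finset.sum_mul, Matrix.trace_sum,
    Complex.re_sum]
  refine mul_nonneg ht (Finset.sum_nonneg fun i _ => ?_)
  rw [Matrix.smul_mul, Matrix.trace_smul, Complex.smul_re]
  exact mul_nonneg (hp i) (h _ ⟨α i, β i, hα i, hβ i, rfl⟩)

/-- Strong duality, by the minimax theorem for the bilinear form
`tr E (ρ - X) + tr F (X - t ρ)`, where `X` ranges over `s σ` with `0 ≤ s ≤ t` and `σ` separable,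
and `(E, F)` over a compact base of the product of two separable cones. -/
theorem hasRatioTest_of_lt_omegaHatSEP [DecidableEq a] [DecidableEq b] {t : ℝ}
    {ρ : Matrix (a × b) (a × b) ℂ} (hρ : IsState ρ) (ht : 0 < t)
    (h : ENNReal.ofReal t < omegaHatSEP ρ) : HasRatioTest t ρ := by
  have := hρ.nonempty
  have : Nonempty a := (nonempty_prod.1 this).1
  have : Nonempty b := (nonempty_prod.1 ‹Nonempty (a × b)›).2
  set P := productStates a b
  have hPc : IsCompact P := isCompact_productStates
  set K : Set (Matrix (a × b) (a × b) ℂ) := convexHull ℝ ({0} ∪ (fun σ => t • σ) '' P)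
  set L : Set (Matrix (a × b) (a × b) ℂ × Matrix (a × b) (a × b) ℂ) :=
    convexHull ℝ ((fun E => (E, 0)) '' P ∪ (fun E => (0, E)) '' P)
  have hKc : IsCompact K := isCompact_convexHull
    (isCompact_singleton.union (hPc.image (by fun_prop)))
  have hLc : IsCompact L := isCompact_convexHull
    ((hPc.image (by fun_prop)).union (hPc.image (by fun_prop)))
  have h0K : (0 : Matrix (a × b) (a × b) ℂ) ∈ K := subset_convexHull _ _ (Or.inl rfl)
  have hσK : ∀ σ, IsSep σ → t • σ ∈ K := by
    intro σ hσ
    have hconv : Convex ℝ ((fun σ : Matrix (a × b) (a × b) ℂ => t • σ) ⁻¹' K) :=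
      (convex_convexHull ℝ _).is_linear_preimage
        ⟨fun x y => smul_add t x y, fun c x => smul_comm t c x⟩
    have hsub : P ⊆ (fun σ : Matrix (a × b) (a × b) ℂ => t • σ) ⁻¹' K :=
      fun σ hσ => subset_convexHull _ _ (Or.inr ⟨σ, hσ, rfl⟩)
    exact convexHull_min hsub hconv (isSep_iff_mem_convexHull.1 hσ)
  have hKS : ∀ X ∈ K, InSepCone X := by
    intro X hX
    refine convexHull_min (t := {X | InSepCone X}) ?_ ?_ hX
    · rintro _ (rfl | ⟨_, ⟨α, β, hα, hβ, rfl⟩, rfl⟩)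
      · exact InSepCone.zero
      · exact (IsSep.of_product hα hβ).inSepCone.smul ht.le
    · intro X hX Y hY c d hc hd _
      exact (InSepCone.smul hX hc).add (InSepCone.smul hY hd)
  have hLS : ∀ Y ∈ L, InSepCone Y.1 ∧ InSepCone Y.2 := by
    intro Y hY
    refine convexHull_min (t := {Y | InSepCone Y.1 ∧ InSepCone Y.2}) ?_ ?_ hY
    · rintro _ (⟨_, ⟨α, β, hα, hβ, rfl⟩, rfl⟩ | ⟨_, ⟨α, β, hα, hβ, rfl⟩, rfl⟩)
      · exact ⟨(IsSep.of_product hα hβ).inSepCone, InSepCone.zero⟩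
      · exact ⟨InSepCone.zero, (IsSep.of_product hα hβ).inSepCone⟩
    · intro X hX Y hY c d hc hd _
      exact ⟨(hX.1.smul hc).add (hY.1.smul hd), (hX.2.smul hc).add (hY.2.smul hd)⟩
  have hL1 : ∀ E ∈ P, ((E, 0) : Matrix (a × b) (a × b) ℂ × Matrix (a × b) (a × b) ℂ) ∈ L :=
    fun E hE => subset_convexHull _ _ (Or.inl ⟨E, hE, rfl⟩)
  have hL2 : ∀ E ∈ P, ((0, E) : Matrix (a × b) (a × b) ℂ × Matrix (a × b) (a × b) ℂ) ∈ L :=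
    fun E hE => subset_convexHull _ _ (Or.inr ⟨E, hE, rfl⟩)
  obtain ⟨α, hα⟩ := exists_isState a
  obtain ⟨β, hβ⟩ := exists_isState b
  let f : Matrix (a × b) (a × b) ℂ → Matrix (a × b) (a × b) ℂ × Matrix (a × b) (a × b) ℂ → ℝ :=
    fun X Y => (Y.1 * ρ).trace.re - (Y.1 * X).trace.re + (Y.2 * X).trace.re -
      t * (Y.2 * ρ).trace.re
  obtain ⟨A, hA, B, hB, hAB⟩ := Sion.exists_isSaddlePointOn (f := f) ⟨0, h0K⟩
    (convex_convexHull ℝ _) hKc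
    (fun Y _ => (Continuous.lowerSemicontinuous (by fun_prop)).lowerSemicontinuousOn _)
    (fun Y _ => ConvexOn.quasiconvexOn ⟨convex_convexHull ℝ _, fun X _ X' _ c d _ _ hcd => by
      obtain rfl : d = 1 - c := by linarith
      simp only [f, Matrix.mul_add, Matrix.mul_smul, Matrix.trace_add, Matrix.trace_smul,
        Complex.add_re, Complex.smul_re, smul_eq_mul]
      exact le_of_eq (by ring)⟩)
    (convex_convexHull ℝ _) ⟨_, hL1 _ ⟨α, β, hα, hβ, rfl⟩⟩ hLc
    (fun X _ => (Continuous.upperSemicontinuous (by fun_prop)).upperSemicontinuousOn _)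
    (fun X _ => ConcaveOn.quasiconcaveOn ⟨convex_convexHull ℝ _, fun Y _ Y' _ c d _ _ hcd => by
      simp only [f, Prod.fst_add, Prod.snd_add, Prod.smul_fst, Prod.smul_snd, Matrix.add_mul,
        Matrix.smul_mul, Matrix.trace_add, Matrix.trace_smul,
        Complex.add_re, Complex.smul_re, smul_eq_mul]
      exact le_of_eq (by ring)⟩)
  obtain ⟨Y, hY, hfY⟩ : ∃ Y ∈ L, 0 < f A Y := by
    by_contra! hcon
    refine h.not_ge ?_
    have h1 : ∀ E, InSepCone E → (E * ρ).trace.re ≤ (E * A).trace.re := by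
      intro E hE
      have := hE.re_trace_mul_nonneg_of_product (X := A - ρ) fun E hE => by
        have := hcon _ (hL1 E hE)
        simp only [f, zero_mul, Matrix.trace_zero, Complex.zero_re] at this
        rw [Matrix.mul_sub, Matrix.trace_sub, Complex.sub_re]
        linarith
      rw [Matrix.mul_sub, Matrix.trace_sub, Complex.sub_re] at this
      linarith
    have h2 : ∀ E, InSepCone E → (E * A).trace.re ≤ t * (E * ρ).trace.re := by
      intro E hE
      have := hE.re_trace_mul_nonneg_of_product (X := t • ρ - A) fun E hE => by
        have := hcon _ (hL2 E hE)
        simp only [f, zero_mul, Matrix.trace_zero, Complex.zero_re] at this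
        rw [Matrix.mul_sub, Matrix.mul_smul, Matrix.trace_sub, Matrix.trace_smul, Complex.sub_re,
          Complex.smul_re, smul_eq_mul]
        linarith
      rw [Matrix.mul_sub, Matrix.mul_smul, Matrix.trace_sub, Matrix.trace_smul, Complex.sub_re,
        Complex.smul_re, smul_eq_mul] at this
      linarith
    obtain ⟨s, σ, hs, hσ, rfl⟩ := hKS A hA
    have hs1 := h1 1 InSepCone.one
    rw [one_mul, one_mul, Matrix.trace_smul, hρ.2, hσ.isState.2] at hs1
    have hs1' : 0 < s := by
      have : 1 ≤ s := by simpa using hs1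
      linarith
    simp only [Matrix.mul_smul, Matrix.trace_smul, Complex.smul_re, smul_eq_mul] at h1 h2
    exact (iInf₂_le σ hσ).trans (omegaSEP_le hρ hσ hs1' ht h1 h2)
  have hpos : ∀ X ∈ K, 0 < f X B := fun X hX => hfY.trans_le (hAB X hX Y hY)
  obtain ⟨hE, hF⟩ := hLS B hB
  have h0 := hpos 0 h0K
  simp only [f, mul_zero, Matrix.trace_zero, Complex.zero_re, sub_zero, add_zero] at h0
  have hFρ := re_trace_mul_nonneg hF.posSemidef hρ.1
  set c : ℝ := ((B.1 * ρ).trace.re - t * (B.2 * ρ).trace.re) / t with hc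
  have htc : t * c = (B.1 * ρ).trace.re - t * (B.2 * ρ).trace.re := by
    rw [hc, mul_div_cancel₀ _ ht.ne']
  -- The identity absorbs the slack left by bounding `s` by `t`.
  refine ⟨B.1, B.2 + c • 1, hE, hF.add (InSepCone.one.smul (by positivity)), fun σ hσ => ?_, ?_, ?_⟩
  · have h1 := hpos _ (hσK σ hσ)
    simp only [f, Matrix.mul_smul, Matrix.trace_smul, Complex.smul_re, smul_eq_mul] at h1
    rw [Matrix.add_mul, Matrix.smul_mul, one_mul, Matrix.trace_add, Matrix.trace_smul,
      hσ.isState.2, Complex.add_re, Complex.smul_re, Complex.one_re, smul_eq_mul, mul_one]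
    refine le_of_mul_le_mul_left ?_ ht
    linarith
  · have := mul_nonneg ht.le hFρ
    linarith
  · rw [Matrix.add_mul, Matrix.smul_mul, one_mul, Matrix.trace_add, Matrix.trace_smul,
      hρ.2, Complex.add_re, Complex.smul_re, Complex.one_re, smul_eq_mul, mul_one]
    linarith

end RatioTest

/-! ### Tensor products of ratio tests -/

section Tensor

theorem sum_comm_four {ι κ μ ν R : Type*} [Fintype ι] [Fintype κ] [Fintype μ] [Fintype ν]
    [AddCommMonoid R] (f : ι → κ → μ → ν → R) :
    ∑ k, ∑ l, ∑ s, ∑ r, f k l s r = ∑ s, ∑ r, ∑ l, ∑ k, f k l s r := by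
  calc ∑ k, ∑ l, ∑ s, ∑ r, f k l s r = ∑ k, ∑ s, ∑ l, ∑ r, f k l s r :=
        Finset.sum_congr rfl fun _ _ => Finset.sum_comm
    _ = ∑ s, ∑ k, ∑ r, ∑ l, f k l s r := by
        rw [Finset.sum_comm]
        exact Finset.sum_congr rfl fun _ _ => Finset.sum_congr rfl fun _ _ => Finset.sum_comm
    _ = ∑ s, ∑ r, ∑ l, ∑ k, f k l s r := Finset.sum_congr rfl fun _ _ => by
        rw [Finset.sum_comm]
        exact Finset.sum_congr rfl fun _ _ => Finset.sum_comm

/-- The operator `tr₂ [(1 ⊗ P) α]`. -/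
def slice {ι κ : Type*} [Fintype κ] (P : Matrix κ κ ℂ) (α : Matrix (ι × κ) (ι × κ) ℂ) :
    Matrix ι ι ℂ :=
  Matrix.of fun x y => ∑ k, ∑ l, P k l * α (x, l) (y, k)

theorem slice_posSemidef {ι κ : Type*} [Fintype ι] [Fintype κ] {P : Matrix κ κ ℂ}
    {α : Matrix (ι × κ) (ι × κ) ℂ} (hP : P.PosSemidef) (hα : α.PosSemidef) :
    (slice P α).PosSemidef := by
  obtain ⟨B, rfl⟩ := exists_eq_conjTranspose_mul hP
  obtain ⟨C, rfl⟩ := exists_eq_conjTranspose_mul hα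
  let D : Matrix (κ × (ι × κ)) ι ℂ := Matrix.of fun s y => ∑ k, star (B s.1 k) * C s.2 (y, k)
  convert Matrix.posSemidef_conjTranspose_mul_self D using 1
  ext x y
  simp only [slice, Matrix.of_apply, Matrix.mul_apply, Matrix.conjTranspose_apply, D, star_sum,
    star_mul', star_star, Finset.sum_mul_sum]
  rw [Fintype.sum_prod_type, sum_comm_four]
  refine Finset.sum_congr rfl fun s _ => Finset.sum_congr rfl fun r _ =>
    Finset.sum_congr rfl fun l _ => Finset.sum_congr rfl fun k _ => ?_
  ring

variable {a b a₁ b₁ a₂ b₂ : Type*}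

/-- The tensor product of operators on the bipartite systems `a₁ : b₁` and `a₂ : b₂`, as an
operator on `a : b`, where `a` and `b` are identified with `a₁ × a₂` and `b₁ × b₂`. -/
def bipartiteTensor (ea : a ≃ a₁ × a₂) (eb : b ≃ b₁ × b₂) (X : Matrix (a₁ × b₁) (a₁ × b₁) ℂ)
    (Y : Matrix (a₂ × b₂) (a₂ × b₂) ℂ) : Matrix (a × b) (a × b) ℂ :=
  Matrix.of fun x y => X ((ea x.1).1, (eb x.2).1) ((ea y.1).1, (eb y.2).1) *
    Y ((ea x.1).2, (eb x.2).2) ((ea y.1).2, (eb y.2).2)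

theorem bipartiteTensor_swap (ea : a ≃ a₁ × a₂) (eb : b ≃ b₁ × b₂)
    (X : Matrix (a₁ × b₁) (a₁ × b₁) ℂ) (Y : Matrix (a₂ × b₂) (a₂ × b₂) ℂ) :
    bipartiteTensor ea eb X Y =
      bipartiteTensor (ea.trans (Equiv.prodComm _ _)) (eb.trans (Equiv.prodComm _ _)) Y X := by
  ext x y
  exact mul_comm _ _

theorem bipartiteTensor_kronecker (ea : a ≃ a₁ × a₂) (eb : b ≃ b₁ × b₂) (P₁ : Matrix a₁ a₁ ℂ)
    (Q₁ : Matrix b₁ b₁ ℂ) (P₂ : Matrix a₂ a₂ ℂ) (Q₂ : Matrix b₂ b₂ ℂ) :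
    bipartiteTensor ea eb (P₁ ⊗ₖ Q₁) (P₂ ⊗ₖ Q₂) =
      (P₁ ⊗ₖ P₂).submatrix ea ea ⊗ₖ (Q₁ ⊗ₖ Q₂).submatrix eb eb := by
  ext x y
  simp only [bipartiteTensor, Matrix.of_apply, Matrix.kroneckerMap_apply, Matrix.submatrix_apply]
  ring

theorem bipartiteTensor_add_left (ea : a ≃ a₁ × a₂) (eb : b ≃ b₁ × b₂)
    (X X' : Matrix (a₁ × b₁) (a₁ × b₁) ℂ) (Y : Matrix (a₂ × b₂) (a₂ × b₂) ℂ) :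
    bipartiteTensor ea eb (X + X') Y =
      bipartiteTensor ea eb X Y + bipartiteTensor ea eb X' Y := by
  ext x y
  simp only [bipartiteTensor, Matrix.of_apply, Matrix.add_apply, add_mul]

theorem bipartiteTensor_sub_left (ea : a ≃ a₁ × a₂) (eb : b ≃ b₁ × b₂)
    (X X' : Matrix (a₁ × b₁) (a₁ × b₁) ℂ) (Y : Matrix (a₂ × b₂) (a₂ × b₂) ℂ) :
    bipartiteTensor ea eb (X - X') Y =
      bipartiteTensor ea eb X Y - bipartiteTensor ea eb X' Y := by
  ext x y
  simp only [bipartiteTensor, Matrix.of_apply, Matrix.sub_apply, sub_mul]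

theorem bipartiteTensor_add_right (ea : a ≃ a₁ × a₂) (eb : b ≃ b₁ × b₂)
    (X : Matrix (a₁ × b₁) (a₁ × b₁) ℂ) (Y Y' : Matrix (a₂ × b₂) (a₂ × b₂) ℂ) :
    bipartiteTensor ea eb X (Y + Y') =
      bipartiteTensor ea eb X Y + bipartiteTensor ea eb X Y' := by
  ext x y
  simp only [bipartiteTensor, Matrix.of_apply, Matrix.add_apply, mul_add]

theorem bipartiteTensor_zero_left (ea : a ≃ a₁ × a₂) (eb : b ≃ b₁ × b₂)
    (Y : Matrix (a₂ × b₂) (a₂ × b₂) ℂ) : bipartiteTensor ea eb 0 Y = 0 := by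
  ext x y
  simp [bipartiteTensor]

theorem bipartiteTensor_zero_right (ea : a ≃ a₁ × a₂) (eb : b ≃ b₁ × b₂)
    (X : Matrix (a₁ × b₁) (a₁ × b₁) ℂ) : bipartiteTensor ea eb X 0 = 0 := by
  ext x y
  simp [bipartiteTensor]

/-- The regrouping `(a₁ × b₁) × (a₂ × b₂) ≃ a × b` that underlies `bipartiteTensor`. -/
def regroup (ea : a ≃ a₁ × a₂) (eb : b ≃ b₁ × b₂) : (a₁ × b₁) × (a₂ × b₂) ≃ a × b :=
  (Equiv.prodProdProdComm a₁ b₁ a₂ b₂).trans (ea.symm.prodCongr eb.symm)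

theorem bipartiteTensor_regroup (ea : a ≃ a₁ × a₂) (eb : b ≃ b₁ × b₂)
    (X : Matrix (a₁ × b₁) (a₁ × b₁) ℂ) (Y : Matrix (a₂ × b₂) (a₂ × b₂) ℂ)
    (x y : (a₁ × b₁) × (a₂ × b₂)) :
    bipartiteTensor ea eb X Y (regroup ea eb x) (regroup ea eb y) = X x.1 y.1 * Y x.2 y.2 := by
  simp [bipartiteTensor, regroup]

variable [Fintype a] [Fintype b] [Fintype a₁] [Fintype b₁] [Fintype a₂] [Fintype b₂]

theorem trace_bipartiteTensor_mul (ea : a ≃ a₁ × a₂) (eb : b ≃ b₁ × b₂)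
    (X : Matrix (a₁ × b₁) (a₁ × b₁) ℂ) (Y : Matrix (a₂ × b₂) (a₂ × b₂) ℂ)
    (Z : Matrix (a × b) (a × b) ℂ) :
    (bipartiteTensor ea eb X Y * Z).trace = ∑ p, ∑ p', X p p' * ∑ q, ∑ q', Y q q' *
      Z (regroup ea eb (p', q')) (regroup ea eb (p, q)) := by
  simp only [Matrix.trace, Matrix.diag_apply, Matrix.mul_apply]
  have hsum : ∀ f : (a₁ × b₁) × (a₂ × b₂) → ℂ, ∑ x, f x = ∑ p, ∑ q, f (p, q) :=
    fun f => Fintype.sum_prod_type f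
  simp_rw [← (regroup ea eb).sum_comp, bipartiteTensor_regroup, hsum]
  simp only [Finset.mul_sum, mul_assoc]
  refine Finset.sum_congr rfl fun p _ => ?_
  rw [Finset.sum_comm]

theorem trace_bipartiteTensor_mul_bipartiteTensor (ea : a ≃ a₁ × a₂) (eb : b ≃ b₁ × b₂)
    (X Z : Matrix (a₁ × b₁) (a₁ × b₁) ℂ) (Y W : Matrix (a₂ × b₂) (a₂ × b₂) ℂ) :
    (bipartiteTensor ea eb X Y * bipartiteTensor ea eb Z W).trace =
      (X * Z).trace * (Y * W).trace := by
  rw [trace_bipartiteTensor_mul]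
  simp only [bipartiteTensor_regroup, Matrix.trace, Matrix.diag_apply, Matrix.mul_apply]
  rw [Finset.sum_mul]
  refine Finset.sum_congr rfl fun p _ => ?_
  rw [Finset.sum_mul]
  refine Finset.sum_congr rfl fun p' _ => ?_
  simp only [Finset.mul_sum]
  refine Finset.sum_congr rfl fun q _ => Finset.sum_congr rfl fun q' _ => ?_
  ring

/-- Pairing with a product effect on the second system leaves a product operator on the first. -/
theorem trace_bipartiteTensor_kronecker_mul_kronecker (ea : a ≃ a₁ × a₂) (eb : b ≃ b₁ × b₂)
    (X : Matrix (a₁ × b₁) (a₁ × b₁) ℂ) (P : Matrix a₂ a₂ ℂ) (Q : Matrix b₂ b₂ ℂ)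
    (α : Matrix a a ℂ) (β : Matrix b b ℂ) :
    (bipartiteTensor ea eb X (P ⊗ₖ Q) * (α ⊗ₖ β)).trace =
      (X * (slice P (α.submatrix ea.symm ea.symm) ⊗ₖ
        slice Q (β.submatrix eb.symm eb.symm))).trace := by
  rw [trace_bipartiteTensor_mul]
  simp only [Matrix.trace, Matrix.diag_apply, Matrix.mul_apply]
  refine Finset.sum_congr rfl fun p _ => Finset.sum_congr rfl fun p' _ => ?_
  congr 1
  simp only [Matrix.kroneckerMap_apply, slice, Matrix.of_apply, Finset.sum_mul_sum,
    Fintype.sum_prod_type, regroup, Matrix.submatrix_apply]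
  refine Finset.sum_congr rfl fun k _ => Finset.sum_congr rfl fun k' _ =>
    Finset.sum_congr rfl fun l _ => Finset.sum_congr rfl fun l' _ => ?_
  simp
  ring

variable [Nonempty a₁] [Nonempty b₁]

theorem InSepCone.bipartiteTensor [Nonempty a₂] [Nonempty b₂] {ea : a ≃ a₁ × a₂} {eb : b ≃ b₁ × b₂}
    {X : Matrix (a₁ × b₁) (a₁ × b₁) ℂ} {Y : Matrix (a₂ × b₂) (a₂ × b₂) ℂ}
    (hX : InSepCone X) (hY : InSepCone Y) : InSepCone (bipartiteTensor ea eb X Y) := by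
  have : Nonempty a := ea.nonempty
  have : Nonempty b := eb.nonempty
  refine hX.induction (p := fun X => InSepCone (Distill.bipartiteTensor ea eb X Y)) ?_ ?_ ?_
  · rw [bipartiteTensor_zero_left]
    exact InSepCone.zero
  · intro X X' h h'
    rw [bipartiteTensor_add_left]
    exact h.add h'
  intro P₁ Q₁ hP₁ hQ₁
  refine hY.induction (p := fun Y => InSepCone (Distill.bipartiteTensor ea eb _ Y)) ?_ ?_ ?_
  · rw [bipartiteTensor_zero_right]
    exact InSepCone.zero
  · intro Y Y' h h'
    rw [bipartiteTensor_add_right]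
    exact h.add h'
  intro P₂ Q₂ hP₂ hQ₂
  rw [bipartiteTensor_kronecker]
  exact InSepCone.kronecker ((hP₁.kronecker hP₂).submatrix ea) ((hQ₁.kronecker hQ₂).submatrix eb)

/-- Tensoring with a separable effect preserves positivity on separable states. -/
theorem bipartiteTensor_pairing_nonneg {ea : a ≃ a₁ × a₂} {eb : b ≃ b₁ × b₂}
    {X : Matrix (a₁ × b₁) (a₁ × b₁) ℂ} (hX : ∀ σ, IsSep σ → 0 ≤ (X * σ).trace.re)
    {Y : Matrix (a₂ × b₂) (a₂ × b₂) ℂ} (hY : InSepCone Y) {σ : Matrix (a × b) (a × b) ℂ}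
    (hσ : IsSep σ) : 0 ≤ (bipartiteTensor ea eb X Y * σ).trace.re := by
  refine hσ.inSepCone.induction (p := fun σ => 0 ≤ (bipartiteTensor ea eb X Y * σ).trace.re)
    (by simp) (fun σ τ h h' => ?_) fun α β hα hβ => ?_
  · rw [mul_add, Matrix.trace_add, Complex.add_re]
    exact add_nonneg h h'
  refine hY.induction
    (p := fun Y => 0 ≤ (bipartiteTensor ea eb X Y * (α ⊗ₖ β)).trace.re) ?_ ?_ ?_
  · simp [bipartiteTensor_zero_right]
  · intro Y Y' h h'
    rw [bipartiteTensor_add_right, add_mul, Matrix.trace_add, Complex.add_re]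
    exact add_nonneg h h'
  intro P Q hP hQ
  rw [trace_bipartiteTensor_kronecker_mul_kronecker]
  obtain ⟨t, τ, ht, hτ, h⟩ := InSepCone.kronecker
    (slice_posSemidef hP (hα.submatrix ea.symm)) (slice_posSemidef hQ (hβ.submatrix eb.symm))
  rw [h, Matrix.mul_smul, Matrix.trace_smul, Complex.smul_re]
  exact mul_nonneg ht (hX τ hτ)

/-- Ratio tests multiply under tensor products: `E₁ ⊗ E₂ ≤ F₁ ⊗ E₂ ≤ F₁ ⊗ F₂` on separable
states. -/
theorem HasRatioTest.bipartiteTensor [Nonempty a₂] [Nonempty b₂] {ea : a ≃ a₁ × a₂}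
    {eb : b ≃ b₁ × b₂} {s t : ℝ}
    {ρ₁ : Matrix (a₁ × b₁) (a₁ × b₁) ℂ} {ρ₂ : Matrix (a₂ × b₂) (a₂ × b₂) ℂ}
    (hρ₁ : ρ₁.PosSemidef) (hρ₂ : ρ₂.PosSemidef) (ht : 0 ≤ t)
    (h₁ : HasRatioTest s ρ₁) (h₂ : HasRatioTest t ρ₂) :
    HasRatioTest (s * t) (bipartiteTensor ea eb ρ₁ ρ₂) := by
  obtain ⟨E₁, F₁, hE₁, hF₁, hσ₁, hpos₁, hle₁⟩ := h₁
  obtain ⟨E₂, F₂, hE₂, hF₂, hσ₂, hpos₂, hle₂⟩ := h₂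
  have hmul : ∀ (X : Matrix (a₁ × b₁) (a₁ × b₁) ℂ) (Y : Matrix (a₂ × b₂) (a₂ × b₂) ℂ),
      InSepCone X → InSepCone Y →
      (Distill.bipartiteTensor ea eb X Y * Distill.bipartiteTensor ea eb ρ₁ ρ₂).trace.re =
        (X * ρ₁).trace.re * (Y * ρ₂).trace.re := by
    intro X Y hX hY
    rw [trace_bipartiteTensor_mul_bipartiteTensor, trace_mul_eq_ofReal hX.posSemidef hρ₁,
      trace_mul_eq_ofReal hY.posSemidef hρ₂, Complex.re_ofReal_mul]
    simp
  refine ⟨_, _, hE₁.bipartiteTensor (ea := ea) (eb := eb) hE₂,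
    hF₁.bipartiteTensor (ea := ea) (eb := eb) hF₂,
    fun σ hσ => ?_, ?_, ?_⟩
  · have h1 := bipartiteTensor_pairing_nonneg (ea := ea) (eb := eb) (X := F₁ - E₁) (fun τ hτ => by
      rw [Matrix.sub_mul, Matrix.trace_sub, Complex.sub_re, sub_nonneg]
      exact hσ₁ τ hτ) hE₂ hσ
    have h2 := bipartiteTensor_pairing_nonneg (ea := ea.trans (Equiv.prodComm _ _))
      (eb := eb.trans (Equiv.prodComm _ _)) (X := F₂ - E₂) (fun τ hτ => by
      rw [Matrix.sub_mul, Matrix.trace_sub, Complex.sub_re, sub_nonneg]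
      exact hσ₂ τ hτ) hF₁ hσ
    rw [bipartiteTensor_sub_left, Matrix.sub_mul, Matrix.trace_sub, Complex.sub_re,
      sub_nonneg] at h1 h2
    rw [← bipartiteTensor_swap, ← bipartiteTensor_swap] at h2
    exact h1.trans h2
  · rw [hmul _ _ hE₁ hE₂]
    exact mul_pos hpos₁ hpos₂
  · rw [hmul _ _ hE₁ hE₂, hmul _ _ hF₁ hF₂]
    calc s * t * ((F₁ * ρ₁).trace.re * (F₂ * ρ₂).trace.re) =
        s * (F₁ * ρ₁).trace.re * (t * (F₂ * ρ₂).trace.re) := by ring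
      _ ≤ _ := mul_le_mul hle₁ hle₂
        (mul_nonneg ht (re_trace_mul_nonneg hF₂.posSemidef hρ₂)) hpos₁.le

end Tensor

/-! ### Tensor powers -/

section TensorPow

variable {a b : Type*}

theorem tensorPow_add (n m : ℕ) (ρ : Matrix (a × b) (a × b) ℂ) :
    tensorPow (n + m) ρ = bipartiteTensor (Fin.appendEquiv n m).symm (Fin.appendEquiv n m).symm
      (tensorPow n ρ) (tensorPow m ρ) := by
  ext x y
  simp only [tensorPow, bipartiteTensor, Matrix.of_apply, Fin.prod_univ_add]
  rfl

variable [Fintype a] [Fintype b]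

theorem sum_prod_arrow (n : ℕ) (f : Fin n → a × b → ℂ) :
    ∑ z : (Fin n → a) × (Fin n → b), ∏ t, f t (z.1 t, z.2 t) = ∏ t, ∑ c, f t c := by
  classical
  rw [Finset.prod_univ_sum, Fintype.piFinset_univ]
  exact Fintype.sum_equiv (Equiv.arrowProdEquivProdArrow _ _ _).symm _ _ fun z => rfl

theorem tensorPow_mul (n : ℕ) (X Y : Matrix (a × b) (a × b) ℂ) :
    tensorPow n (X * Y) = tensorPow n X * tensorPow n Y := by
  ext x y
  simp only [tensorPow, Matrix.of_apply, Matrix.mul_apply, ← Finset.prod_mul_distrib]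
  exact (sum_prod_arrow n fun t c => X (x.1 t, x.2 t) c * Y c (y.1 t, y.2 t)).symm

theorem IsState.tensorPow {ρ : Matrix (a × b) (a × b) ℂ} (hρ : IsState ρ) (n : ℕ) :
    IsState (tensorPow n ρ) := by
  constructor
  · obtain ⟨B, rfl⟩ := exists_eq_conjTranspose_mul hρ.1
    have h : Distill.tensorPow n B.conjTranspose = (Distill.tensorPow n B).conjTranspose := by
      ext x y
      simp [Distill.tensorPow]
    rw [tensorPow_mul, h]
    exact Matrix.posSemidef_conjTranspose_mul_self _
  · have h := sum_prod_arrow n fun _ (c : a × b) => ρ c c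
    have h1 : ∑ c, ρ c c = 1 := hρ.2
    simp only [h1, Finset.prod_const_one] at h
    exact h

end TensorPow

/-! ### The maximally entangled state -/

section MaxEnt

theorem maxEnt_apply (m : ℕ) (x y : Fin m × Fin m) :
    maxEnt m x y = if x.1 = x.2 ∧ y.1 = y.2 then ((m : ℂ))⁻¹ else 0 := by
  have h : ((Real.sqrt m : ℝ) : ℂ) * ((Real.sqrt m : ℝ) : ℂ) = m := by
    rw [← Complex.ofReal_mul, Real.mul_self_sqrt (Nat.cast_nonneg m), Complex.ofReal_natCast]
  simp only [maxEnt, Matrix.vecMulVec_apply, maxEntVec, Pi.star_apply]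
  split_ifs <;> simp_all [← mul_inv]

theorem maxEnt_posSemidef (m : ℕ) : (maxEnt m).PosSemidef :=
  Matrix.posSemidef_vecMulVec_self_star _

theorem star_maxEntVec_dotProduct {m : ℕ} (hm : m ≠ 0) :
    star (maxEntVec m) ⬝ᵥ maxEntVec m = 1 := by
  have h : (star (maxEntVec m) ⬝ᵥ maxEntVec m) = (maxEnt m).trace := by
    rw [maxEnt, Matrix.trace_vecMulVec, dotProduct_comm]
  rw [h]
  simp only [Matrix.trace, Matrix.diag_apply, maxEnt_apply, and_self, Fintype.sum_prod_type]
  simp [hm]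

theorem trace_maxEnt {m : ℕ} (hm : m ≠ 0) : (maxEnt m).trace = 1 := by
  rw [maxEnt, Matrix.trace_vecMulVec, dotProduct_comm, star_maxEntVec_dotProduct hm]

theorem maxEnt_mul_mul_maxEnt (m : ℕ) (X : Matrix (Fin m × Fin m) (Fin m × Fin m) ℂ) :
    maxEnt m * X * maxEnt m = (maxEnt m * X).trace • maxEnt m := by
  rw [maxEnt, Matrix.vecMulVec_mul, Matrix.vecMulVec_mul_vecMulVec, Matrix.trace_vecMulVec,
    dotProduct_comm]
  ext x y
  simp [Matrix.vecMulVec_apply]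
  ring

theorem maxEnt_mul_self {m : ℕ} (hm : m ≠ 0) : maxEnt m * maxEnt m = maxEnt m := by
  have h := maxEnt_mul_mul_maxEnt m 1
  rwa [mul_one, trace_maxEnt hm, one_smul] at h

/-- The fidelity with a pure state is the square root of the overlap. -/
theorem fidelity_maxEnt {m : ℕ} (hm : m ≠ 0) {X : Matrix (Fin m × Fin m) (Fin m × Fin m) ℂ}
    (hX : X.PosSemidef) : fidelity X (maxEnt m) = Real.sqrt (maxEnt m * X).trace.re := by
  have h1 : CFC.sqrt (maxEnt m) = maxEnt m :=
    CFC.sqrt_unique (maxEnt_mul_self hm) (maxEnt_posSemidef m).nonneg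
  have h2 : CFC.sqrt X * CFC.sqrt X = X := CFC.sqrt_mul_sqrt_self X hX.nonneg
  have h3 : (CFC.sqrt X).conjTranspose = CFC.sqrt X :=
    (Matrix.nonneg_iff_posSemidef.1 (CFC.sqrt_nonneg X)).isHermitian
  have h4 : (CFC.sqrt X * maxEnt m).conjTranspose * (CFC.sqrt X * maxEnt m) =
      (maxEnt m * X).trace • maxEnt m := by
    rw [Matrix.conjTranspose_mul, h3, (maxEnt_posSemidef m).isHermitian.eq,
      ← maxEnt_mul_mul_maxEnt]
    calc _ = maxEnt m * (CFC.sqrt X * CFC.sqrt X) * maxEnt m := by simp only [mul_assoc]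
      _ = _ := by rw [h2]
  have h5 : 0 ≤ (maxEnt m * X).trace.re := re_trace_mul_nonneg (maxEnt_posSemidef m) hX
  have h6 : CFC.sqrt ((maxEnt m * X).trace • maxEnt m) =
      Real.sqrt (maxEnt m * X).trace.re • maxEnt m := by
    refine CFC.sqrt_unique ?_ (posSemidef_smul (maxEnt_posSemidef m) (Real.sqrt_nonneg _)).nonneg
    rw [smul_mul_smul_comm, maxEnt_mul_self hm, Real.mul_self_sqrt h5]
    conv_rhs => rw [trace_mul_eq_ofReal (maxEnt_posSemidef m) hX]
    ext x y
    simp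
  rw [fidelity, h1, traceNorm, h4, h6, Matrix.trace_smul, trace_maxEnt hm]
  simp

/-- Separable operators have overlap at most `1 / m` with the maximally entangled state. -/
theorem InSepCone.mul_trace_maxEnt_le {m : ℕ} {X : Matrix (Fin m × Fin m) (Fin m × Fin m) ℂ}
    (hX : InSepCone X) : m * (maxEnt m * X).trace.re ≤ X.trace.re := by
  rcases eq_or_ne m 0 with rfl | hm
  · simp
  refine hX.induction (p := fun X => m * (maxEnt m * X).trace.re ≤ X.trace.re) (by simp)
    (fun X Y h h' => ?_) fun P Q hP hQ => ?_
  · simp only [mul_add, Matrix.trace_add, Complex.add_re]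
    exact add_le_add h h'
  have h1 : (m : ℂ) * (maxEnt m * (P ⊗ₖ Q)).trace = (P * Q.transpose).trace := by
    have hm' : (m : ℂ) ≠ 0 := Nat.cast_ne_zero.2 hm
    simp only [Matrix.trace, Matrix.diag_apply, Matrix.mul_apply, Matrix.kroneckerMap_apply,
      maxEnt_apply, Matrix.transpose_apply, Fintype.sum_prod_type, Finset.mul_sum]
    simp only [ite_and, ite_mul, zero_mul, mul_ite, mul_zero, Finset.sum_ite_eq, Finset.mem_univ,
      if_true, Finset.sum_const_zero, mul_inv_cancel_left₀ hm', Finset.sum_ite_irrel]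
    rw [Finset.sum_comm]
  have h2 := re_trace_mul_nonneg hP (posSemidef_trace_smul_one_sub hQ.transpose)
  have h3 : ((m : ℂ) * (maxEnt m * (P ⊗ₖ Q)).trace).re =
      m * (maxEnt m * (P ⊗ₖ Q)).trace.re := by
    rw [← Complex.ofReal_natCast, Complex.re_ofReal_mul]
  rw [Matrix.mul_sub, Matrix.trace_sub, Complex.sub_re, ← h1, h3, Matrix.mul_smul, mul_one,
    Matrix.trace_smul, Complex.smul_re, smul_eq_mul, Matrix.trace_transpose] at h2
  rw [Matrix.trace_kronecker, trace_eq_ofReal hP, trace_eq_ofReal hQ, ← Complex.ofReal_mul,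
    Complex.ofReal_re]
  linarith

theorem InSepCone.diagonal {a b : Type*} [Fintype a] [Fintype b] [DecidableEq a] [DecidableEq b]
    [Nonempty a] [Nonempty b] {d : a × b → ℂ} (hd : ∀ x, 0 ≤ d x) :
    InSepCone (Matrix.diagonal d) := by
  have h : Matrix.diagonal d = ∑ x : a × b,
      Matrix.diagonal (Pi.single x.1 (d x)) ⊗ₖ Matrix.diagonal (Pi.single x.2 1) := by
    ext y z
    rw [Matrix.sum_apply]
    simp only [Matrix.diagonal_kronecker_diagonal, Matrix.diagonal_apply]
    split_ifs with hyz
    · rw [Finset.sum_eq_single y]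
      · simp
      · rintro x - hx
        by_cases h1 : y.1 = x.1
        · have h2 : y.2 ≠ x.2 := fun h2 => hx (Prod.ext h1.symm h2.symm)
          simp [Pi.single_eq_of_ne h2]
        · simp [Pi.single_eq_of_ne h1]
      · simp
    · simp
  rw [h]
  refine InSepCone.sum _ fun x _ => InSepCone.kronecker (Matrix.PosSemidef.diagonal ?_)
    (Matrix.PosSemidef.diagonal ?_)
  · exact Pi.single_nonneg.2 (hd x)
  · exact Pi.single_nonneg.2 zero_le_one

/-! ### Separability of isotropic operators -/

/-- The vector `∑ᵢ ωᵢ |i⟩` of third roots of unity `ωᵢ = e^{2πi wᵢ / 3}`. -/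
def phaseVec {m : ℕ} (w : Fin m → ZMod 3) : Fin m → ℂ :=
  fun i => ZMod.stdAddChar (w i)

theorem star_phaseVec {m : ℕ} (w : Fin m → ZMod 3) (i : Fin m) :
    star (phaseVec w i) = ZMod.stdAddChar (-w i) :=
  (AddChar.map_neg_eq_conj _ _).symm

theorem star_phaseVec_dotProduct {m : ℕ} (w : Fin m → ZMod 3) :
    star (phaseVec w) ⬝ᵥ phaseVec w = m := by
  have h : ∀ i, star (phaseVec w i) * phaseVec w i = 1 := fun i => by
    rw [star_phaseVec, phaseVec, ← AddChar.map_add_eq_mul, neg_add_cancel, AddChar.map_zero_eq_one]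
  simp only [dotProduct, Pi.star_apply, h]
  simp

/-- Averaging over independent third roots of unity annihilates every monomial
`ωᵢ ω̄ₖ ω̄ⱼ ωₗ` that is not identically one. -/
theorem sum_stdAddChar {m : ℕ} (i j k l : Fin m) :
    ∑ w : Fin m → ZMod 3, (ZMod.stdAddChar (w i - w k - w j + w l) : ℂ) =
      if (i = j ∧ k = l) ∨ (i = k ∧ j = l) then 3 ^ m else 0 := by
  split_ifs with h
  · have h0 : ∀ w : Fin m → ZMod 3, w i - w k - w j + w l = 0 := by
      intro w
      rcases h with ⟨rfl, rfl⟩ | ⟨rfl, rfl⟩ <;> ring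
    simp [h0, AddChar.map_zero_eq_one]
  · obtain ⟨v, hv⟩ : ∃ v : Fin m → ZMod 3, v i - v k - v j + v l ≠ 0 := by
      by_cases hj : i = j
      · subst hj
        have hkl : k ≠ l := fun hkl => h (Or.inl ⟨rfl, hkl⟩)
        refine ⟨Pi.single k 1, ?_⟩
        rw [Pi.single_eq_same, Pi.single_eq_of_ne hkl.symm]
        intro h0
        have : (Pi.single k 1 : Fin m → ZMod 3) i - 1 - (Pi.single k 1 : Fin m → ZMod 3) i + 0 =
            -1 := by ring
        rw [this] at h0
        exact absurd h0 (by decide)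
      by_cases hk : i = k
      · subst hk
        have hjl : j ≠ l := fun hjl => h (Or.inr ⟨rfl, hjl⟩)
        refine ⟨Pi.single j 1, ?_⟩
        rw [Pi.single_eq_same, Pi.single_eq_of_ne hjl.symm, Pi.single_eq_of_ne hj]
        decide
      · refine ⟨Pi.single i 1, ?_⟩
        rw [Pi.single_eq_same, Pi.single_eq_of_ne (Ne.symm hk), Pi.single_eq_of_ne (Ne.symm hj)]
        by_cases hl : l = i
        · rw [hl, Pi.single_eq_same]
          decide
        · rw [Pi.single_eq_of_ne hl]
          decide
    -- Translation by `v` multiplies the sum by a nontrivial phase.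
    set S := ∑ w : Fin m → ZMod 3, (ZMod.stdAddChar (w i - w k - w j + w l) : ℂ) with hS
    have h1 : S = ZMod.stdAddChar (v i - v k - v j + v l) * S := by
      rw [hS, Finset.mul_sum]
      refine (Fintype.sum_equiv (Equiv.addRight v) _ _ fun w => ?_).symm
      rw [← AddChar.map_add_eq_mul]
      congr 1
      simp only [Equiv.coe_addRight, Pi.add_apply]
      ring
    have h2 : (ZMod.stdAddChar (v i - v k - v j + v l) : ℂ) ≠ 1 := fun h2 => hv <|
      ZMod.injective_stdAddChar (h2.trans (AddChar.map_zero_eq_one _).symm)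
    have h3 : (ZMod.stdAddChar (v i - v k - v j + v l) - 1) * S = 0 := by
      rw [sub_mul, ← h1, one_mul, sub_self]
    exact (mul_eq_zero.1 h3).resolve_left (sub_ne_zero.2 h2)

/-- The rank-one operator `|φ⟩⟨φ|` of a vector of phases. -/
def phaseProj {m : ℕ} (w : Fin m → ZMod 3) : Matrix (Fin m) (Fin m) ℂ :=
  Matrix.vecMulVec (phaseVec w) (star (phaseVec w))

theorem phaseProj_apply {m : ℕ} (w : Fin m → ZMod 3) (i k : Fin m) :
    phaseProj w i k = ZMod.stdAddChar (w i - w k) := by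
  rw [phaseProj, Matrix.vecMulVec_apply, Pi.star_apply, star_phaseVec, phaseVec,
    ← AddChar.map_add_eq_mul, sub_eq_add_neg]

theorem phaseProj_posSemidef {m : ℕ} (w : Fin m → ZMod 3) : (phaseProj w).PosSemidef :=
  Matrix.posSemidef_vecMulVec_self_star _

theorem smul_one_sub_phaseProj_posSemidef {m : ℕ} (w : Fin m → ZMod 3) :
    ((m : ℝ) • (1 : Matrix (Fin m) (Fin m) ℂ) - phaseProj w).PosSemidef :=
  posSemidef_smul_one_sub_vecMulVec _ (by simpa using star_phaseVec_dotProduct w)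

theorem sum_phaseProj_kronecker (m : ℕ) :
    ∑ w : Fin m → ZMod 3, phaseProj w ⊗ₖ (phaseProj w).transpose =
      (3 ^ m : ℝ) • ((m : ℝ) • maxEnt m + Matrix.diagonal fun x => if x.1 = x.2 then 0 else 1) := by
  ext x y
  have h : ∀ w : Fin m → ZMod 3, (phaseProj w ⊗ₖ (phaseProj w).transpose) x y =
      ZMod.stdAddChar (w x.1 - w y.1 - w x.2 + w y.2) := by
    intro w
    rw [Matrix.kroneckerMap_apply, Matrix.transpose_apply, phaseProj_apply, phaseProj_apply,
      ← AddChar.map_add_eq_mul]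
    congr 1
    ring
  have hm : (m : ℂ) ≠ 0 := Nat.cast_ne_zero.2 (Fin.pos x.1).ne'
  rw [Matrix.sum_apply, Finset.sum_congr rfl fun w _ => h w, sum_stdAddChar]
  simp only [Matrix.smul_apply, Matrix.add_apply, maxEnt_apply, Matrix.diagonal_apply,
    Complex.real_smul, Prod.ext_iff]
  by_cases h1 : x.1 = x.2 ∧ y.1 = y.2
  · simp [h1, hm]
  · by_cases h2 : x.1 = y.1 ∧ x.2 = y.2
    · have h3 : x.1 ≠ x.2 := fun h3 => h1 ⟨h3, by rw [← h2.1, ← h2.2, h3]⟩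
      rw [if_pos (Or.inr h2), if_neg h1, if_pos h2, if_neg h3]
      simp
    · rw [if_neg (by tauto), if_neg h1, if_neg h2]
      simp

theorem sum_phaseProj_kronecker_one (m : ℕ) :
    ∑ w : Fin m → ZMod 3, phaseProj w ⊗ₖ ((m : ℝ) • (1 : Matrix (Fin m) (Fin m) ℂ)) =
      (3 ^ m : ℝ) • ((m : ℝ) • (1 : Matrix (Fin m × Fin m) (Fin m × Fin m) ℂ)) := by
  have h : ∑ w : Fin m → ZMod 3, phaseProj w = (3 ^ m : ℝ) • (1 : Matrix (Fin m) (Fin m) ℂ) := by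
    ext i k
    have h1 := sum_stdAddChar i k k k
    have h2 : ∀ w : Fin m → ZMod 3, phaseProj w i k =
        ZMod.stdAddChar (w i - w k - w k + w k) := fun w => by
      rw [phaseProj_apply, sub_add_cancel]
    rw [Matrix.sum_apply, Finset.sum_congr rfl fun w _ => h2 w, h1]
    by_cases hik : i = k <;> simp [hik]
  rw [← Matrix.one_kronecker_one]
  ext x y
  have h3 := congrFun (congrFun h x.1) y.1
  rw [Matrix.sum_apply] at h3
  simp only [Matrix.sum_apply, Matrix.kroneckerMap_apply, Matrix.smul_apply, ← Finset.sum_mul, h3]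
  simp only [Complex.real_smul]
  ring

/-- The extremal isotropic separable operator: `1 + m Ψ` is the average of the product operators
`|φ⟩⟨φ| ⊗ |φ̄⟩⟨φ̄|` over vectors of phases, plus a diagonal operator. -/
theorem inSepCone_one_add_maxEnt {m : ℕ} (hm : m ≠ 0) :
    InSepCone (1 + (m : ℝ) • maxEnt m) := by
  have : NeZero m := ⟨hm⟩
  have h1 : InSepCone (∑ w : Fin m → ZMod 3, phaseProj w ⊗ₖ (phaseProj w).transpose) :=
    InSepCone.sum _ fun w _ =>
      InSepCone.kronecker (phaseProj_posSemidef w) (phaseProj_posSemidef w).transpose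
  rw [sum_phaseProj_kronecker] at h1
  have h2 := h1.smul (s := (3 ^ m : ℝ)⁻¹) (by positivity)
  rw [smul_smul, inv_mul_cancel₀ (by positivity), one_smul] at h2
  have h3 : InSepCone (Matrix.diagonal fun x : Fin m × Fin m => if x.1 = x.2 then (1 : ℂ) else 0) :=
    InSepCone.diagonal fun x => by split_ifs <;> simp
  convert h2.add h3 using 1
  rw [add_assoc, Matrix.diagonal_add, add_comm, ← Matrix.diagonal_one]
  congr 2
  ext x
  split_ifs <;> simp

/-- `m (1 - Ψ)` is the average of `|φ⟩⟨φ| ⊗ (m - |φ̄⟩⟨φ̄|)` over vectors of phases, plus a diagonal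
operator. -/
theorem inSepCone_one_sub_maxEnt {m : ℕ} (hm : m ≠ 0) : InSepCone (1 - maxEnt m) := by
  have : NeZero m := ⟨hm⟩
  have h1 : InSepCone (∑ w : Fin m → ZMod 3,
      phaseProj w ⊗ₖ ((m : ℝ) • (1 : Matrix (Fin m) (Fin m) ℂ) - (phaseProj w).transpose)) := by
    refine InSepCone.sum _ fun w _ => InSepCone.kronecker (phaseProj_posSemidef w) ?_
    have h := (smul_one_sub_phaseProj_posSemidef w).transpose
    rwa [Matrix.transpose_sub, Matrix.transpose_smul, Matrix.transpose_one] at h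
  have hsub : ∀ w : Fin m → ZMod 3,
      phaseProj w ⊗ₖ ((m : ℝ) • (1 : Matrix (Fin m) (Fin m) ℂ) - (phaseProj w).transpose) =
        phaseProj w ⊗ₖ ((m : ℝ) • (1 : Matrix (Fin m) (Fin m) ℂ)) -
          phaseProj w ⊗ₖ (phaseProj w).transpose := fun w => by
    ext x y
    exact mul_sub _ _ _
  rw [Finset.sum_congr rfl fun w _ => hsub w, Finset.sum_sub_distrib, sum_phaseProj_kronecker, sum_phaseProj_kronecker_one,
    ← smul_sub] at h1
  have h2 := h1.smul (s := (3 ^ m : ℝ)⁻¹) (by positivity)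
  rw [smul_smul, inv_mul_cancel₀ (by positivity), one_smul] at h2
  have h3 : InSepCone (Matrix.diagonal fun x : Fin m × Fin m => if x.1 = x.2 then (0 : ℂ) else 1) :=
    InSepCone.diagonal fun x => by split_ifs <;> simp
  have h4 := (h2.add h3).smul (s := (m : ℝ)⁻¹) (by positivity)
  convert h4 using 1
  rw [← sub_sub, sub_add_cancel, ← smul_sub, smul_smul,
    inv_mul_cancel₀ (Nat.cast_ne_zero.2 hm), one_smul]

end MaxEnt

/-! ### The base-two logarithm -/

theorem log2_mono : Monotone log2 := fun _ _ h =>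
  EReal.div_le_div_right_of_nonneg (EReal.coe_nonneg.2 (Real.log_nonneg one_le_two))
    (ENNReal.log_monotone h)

theorem log2_one : log2 1 = 0 := by simp [log2]

theorem log2_ofReal {x : ℝ} (hx : 0 < x) : log2 (ENNReal.ofReal x) = (Real.logb 2 x : ℝ) := by
  rw [log2, ENNReal.log_ofReal_of_pos hx, ← EReal.coe_div, Real.logb]

theorem log2_top : log2 ⊤ = ⊤ := by
  rw [log2, ENNReal.log_top]
  exact EReal.top_div_of_pos_ne_top (EReal.coe_pos.2 (Real.log_pos one_lt_two)) (EReal.coe_ne_top _)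

theorem log2_inv (x : ℝ≥0∞) : log2 x⁻¹ = -log2 x := by
  rw [log2, log2, ENNReal.log_inv]
  exact EReal.neg_mul _ _

theorem log2_mul (x y : ℝ≥0∞) : log2 (x * y) = log2 x + log2 y := by
  rw [log2, log2, log2, ENNReal.log_mul_add,
    EReal.add_div_of_nonneg_right (EReal.coe_nonneg.2 (Real.log_nonneg one_le_two))]

/-! ### Completely positive maps -/

section Instruments

variable {ι κ : Type*}

theorem heisenberg_add_map [Fintype κ] [DecidableEq ι]
    (Φ Ψ : Matrix ι ι ℂ →ₗ[ℂ] Matrix κ κ ℂ) (X : Matrix κ κ ℂ) :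
    heisenberg (Φ + Ψ) X = heisenberg Φ X + heisenberg Ψ X := by
  ext i j
  simp [heisenberg, mul_add]

theorem heisenberg_smul [Fintype κ] [DecidableEq ι]
    (Φ : Matrix ι ι ℂ →ₗ[ℂ] Matrix κ κ ℂ) (t : ℝ) (X : Matrix κ κ ℂ) :
    heisenberg Φ (t • X) = t • heisenberg Φ X := by
  ext i j
  simp [heisenberg]

variable [Fintype ι]

/-- The map `X ↦ tr (E X) G` that tests the effect `E` and prepares `G`. -/
def testPrepare (E : Matrix ι ι ℂ) (G : Matrix κ κ ℂ) : Matrix ι ι ℂ →ₗ[ℂ] Matrix κ κ ℂ where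
  toFun X := (E * X).trace • G
  map_add' X Y := by rw [mul_add, Matrix.trace_add, add_smul]
  map_smul' c X := by simp [smul_smul]

theorem testPrepare_apply (E X : Matrix ι ι ℂ) (G : Matrix κ κ ℂ) :
    testPrepare E G X = (E * X).trace • G := rfl

variable [Fintype κ]

theorem IsCP.posSemidef {Φ : Matrix ι ι ℂ →ₗ[ℂ] Matrix κ κ ℂ} (hΦ : IsCP Φ) {X : Matrix ι ι ℂ}
    (hX : X.PosSemidef) : (Φ X).PosSemidef :=
  (hΦ 1 (X.submatrix Prod.snd Prod.snd) (hX.submatrix _)).submatrix fun i => ((0 : Fin 1), i)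

theorem IsCP.add {Φ Ψ : Matrix ι ι ℂ →ₗ[ℂ] Matrix κ κ ℂ} (hΦ : IsCP Φ) (hΨ : IsCP Ψ) :
    IsCP (Φ + Ψ) := fun k X hX => (hΦ k X hX).add (hΨ k X hX)

theorem isCP_testPrepare {E : Matrix ι ι ℂ} {G : Matrix κ κ ℂ} (hE : E.PosSemidef)
    (hG : G.PosSemidef) : IsCP (testPrepare E G) := by
  intro k X hX
  have h : ampliation k (testPrepare E G) X = slice E X ⊗ₖ G := by
    ext x y
    simp only [ampliation, Matrix.of_apply, testPrepare_apply, Matrix.smul_apply, smul_eq_mul,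
      Matrix.kroneckerMap_apply, slice, Matrix.trace, Matrix.diag_apply, Matrix.mul_apply]
  rw [h]
  exact (slice_posSemidef hE hX).kronecker hG

variable [DecidableEq ι]

theorem heisenberg_testPrepare (E : Matrix ι ι ℂ) (G X : Matrix κ κ ℂ) :
    heisenberg (testPrepare E G) X = (X * G).trace • E := by
  ext i j
  simp [heisenberg, testPrepare_apply, Matrix.trace_mul_single, mul_comm]

end Instruments

/-! ### From ratio tests to distillation -/

section Achievability

variable {a b : Type*} [Fintype a] [Fintype b]

theorem hilbertDSubSep_nonpos {X : Matrix (a × b) (a × b) ℂ} (hX : IsSubSep X) :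
    hilbertDSubSep X ≤ 0 := by
  refine (iInf₂_le X hX).trans ?_
  rw [hilbertD, ← log2_one]
  refine log2_mono (iInf₂_le_of_le 1 ⟨fun v => Iff.rfl, 1, ?_, ?_⟩ le_rfl) <;>
  simp [Matrix.PosSemidef.zero]

theorem InSepCone.complex_smul {c : ℝ} {X : Matrix (a × b) (a × b) ℂ} (hX : InSepCone X) {z : ℂ}
    (hz : z = c) (hc : 0 ≤ c) : InSepCone (z • X) := by
  rw [hz, Complex.coe_smul]
  exact hX.smul hc

theorem trace_one_sub_maxEnt {m : ℕ} (hm : m ≠ 0) :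
    ((1 - maxEnt m : Matrix (Fin m × Fin m) (Fin m × Fin m) ℂ)).trace = (m : ℂ) ^ 2 - 1 := by
  rw [Matrix.trace_sub, trace_maxEnt hm, Matrix.trace_one]
  simp [sq]

/-- Achievability: the instrument measures `E`, `F` and prepares `Ψ_m`, respectively a multiple of
`1 - Ψ_m`; the remaining effect is separable too and leads to a second branch that prepares a fixed
product state. -/
theorem distillable_of_hasRatioTest [DecidableEq a] [DecidableEq b] {δ : ℝ} (hδ : 0 ≤ δ) {m : ℕ}
    (hm : 2 ≤ m) {ρ : Matrix (a × b) (a × b) ℂ} (hρ : IsState ρ) {t : ℝ} (ht : 0 < t)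
    (h : HasRatioTest t ρ) {ε : ℝ≥0} (hε : (m - 1) / t ≤ ε) : Distillable δ m ρ ε := by
  obtain ⟨E₀, F₀, hE₀, hF₀, hσ₀, hpos₀, hle₀⟩ := h
  have hm0 : m ≠ 0 := by omega
  have : NeZero m := ⟨hm0⟩
  have hm1 : (0 : ℝ) ≤ m - 1 := by
    have : (2 : ℝ) ≤ m := by exact_mod_cast hm
    linarith
  have hEF₀ := hE₀.add (hF₀.smul hm1)
  set c : ℝ := (1 + (E₀ + ((m : ℝ) - 1) • F₀).trace.re)⁻¹ with hc
  have hEF₀' := re_trace_nonneg hEF₀.posSemidef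
  have hc0 : 0 < c := by positivity
  -- After rescaling, `E`, `F` and the complementary effect `G` are separable.
  obtain ⟨E, hEdef⟩ : ∃ E, E = c • E₀ := ⟨_, rfl⟩
  obtain ⟨F, hFdef⟩ : ∃ F, F = c • F₀ := ⟨_, rfl⟩
  have hE : InSepCone E := hEdef ▸ hE₀.smul hc0.le
  have hF : InSepCone F := hFdef ▸ hF₀.smul hc0.le
  have hG : InSepCone (1 - (E + ((m : ℝ) - 1) • F)) := by
    refine (hE.add (hF.smul hm1)).one_sub ?_
    have : E + ((m : ℝ) - 1) • F = c • (E₀ + ((m : ℝ) - 1) • F₀) := by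
      rw [hEdef, hFdef, smul_add, smul_comm]
    rw [this, Matrix.trace_smul, Complex.smul_re, smul_eq_mul, hc,
      inv_mul_le_iff₀ (by positivity)]
    linarith
  have hσ : ∀ σ, IsSep σ → (E * σ).trace.re ≤ (F * σ).trace.re := by
    intro σ hσ
    simp only [hEdef, hFdef, Matrix.smul_mul, Matrix.trace_smul, Complex.smul_re, smul_eq_mul]
    exact mul_le_mul_of_nonneg_left (hσ₀ σ hσ) hc0.le
  have hpos : 0 < (E * ρ).trace.re := by
    simp only [hEdef, Matrix.smul_mul, Matrix.trace_smul, Complex.smul_re, smul_eq_mul]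
    exact mul_pos hc0 hpos₀
  have hle : t * (F * ρ).trace.re ≤ (E * ρ).trace.re := by
    simp only [hEdef, hFdef, Matrix.smul_mul, Matrix.trace_smul, Complex.smul_re, smul_eq_mul]
    rw [mul_left_comm]
    exact mul_le_mul_of_nonneg_left hle₀ hc0.le
  clear hEF₀' hEF₀ hσ₀ hpos₀ hle₀
  set G := 1 - (E + ((m : ℝ) - 1) • F) with hGdef
  -- `Ψ + T` is the separable isotropic operator with the largest overlap with `Ψ`.
  obtain ⟨T, hT⟩ : ∃ T, T = ((m : ℝ) + 1)⁻¹ • (1 - maxEnt m) := ⟨_, rfl⟩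
  have hTS : InSepCone T := hT ▸ (inSepCone_one_sub_maxEnt hm0).smul (by positivity)
  have hΨT : InSepCone (maxEnt m + T) := by
    convert (inSepCone_one_add_maxEnt hm0).smul (s := ((m : ℝ) + 1)⁻¹) (by positivity) using 1
    rw [hT]
    match_scalars
    · field_simp
      ring
    · simp
  have hTtr : T.trace = ((m - 1 : ℝ) : ℂ) := by
    rw [hT, Matrix.trace_smul, trace_one_sub_maxEnt hm0, Complex.real_smul]
    push_cast
    have : (m : ℂ) + 1 ≠ 0 := by exact_mod_cast Nat.succ_ne_zero m
    field_simp
    ring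
  have hΨTmul : maxEnt m * T = 0 := by
    rw [hT, Matrix.mul_smul, mul_sub, mul_one, maxEnt_mul_self hm0, sub_self, smul_zero]
  obtain ⟨s₀, hs₀⟩ := exists_isSep (Fin m) (Fin m)
  set Φ := testPrepare E (maxEnt m) + testPrepare F T with hΦ
  have hΦapp : ∀ X, Φ X = (E * X).trace • maxEnt m + (F * X).trace • T := fun X => rfl
  have hΦtr : ∀ X, (Φ X).trace = (E * X).trace + (m - 1 : ℝ) * (F * X).trace := by
    intro X
    rw [hΦapp, Matrix.trace_add, Matrix.trace_smul, Matrix.trace_smul, trace_maxEnt hm0, hTtr,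
      smul_eq_mul, smul_eq_mul, mul_one, mul_comm (F * X).trace]
  have hGtr : ∀ X, (G * X).trace = X.trace - (Φ X).trace := by
    intro X
    rw [hΦtr, hGdef, sub_mul, add_mul, one_mul, Matrix.smul_mul, Matrix.trace_sub,
      Matrix.trace_add, Matrix.trace_smul, Complex.real_smul]
  refine ⟨2, ![Φ, testPrepare G s₀], 0, ⟨⟨⟨?_, ?_⟩, ?_⟩, ?_⟩, ?_, ?_⟩
  · intro i
    fin_cases i
    · exact (isCP_testPrepare hE.posSemidef (maxEnt_posSemidef m)).add
        (isCP_testPrepare hF.posSemidef hTS.posSemidef)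
    · exact isCP_testPrepare hG.posSemidef hs₀.isState.1
  · intro X
    rw [Fin.sum_univ_two]
    simp [testPrepare_apply, hs₀.isState.2, hGtr]
  · intro i σ hs
    refine (hilbertDSubSep_nonpos ?_).trans (EReal.coe_nonneg.2 hδ)
    have hp := re_trace_mul_nonneg hE.posSemidef hs.isState.1
    have hq := re_trace_mul_nonneg hF.posSemidef hs.isState.1
    have hg := re_trace_mul_nonneg hG.posSemidef hs.isState.1
    have hgtr := hGtr σ
    rw [hs.isState.2] at hgtr
    fin_cases i
    · have h1 : InSepCone (Φ σ) := by
        rw [hΦapp, trace_mul_eq_ofReal hE.posSemidef hs.isState.1,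
          trace_mul_eq_ofReal hF.posSemidef hs.isState.1, Complex.coe_smul, Complex.coe_smul]
        convert (hΨT.smul hp).add (hTS.smul (sub_nonneg.2 (hσ σ hs))) using 1
        module
      refine h1.isSubSep ?_
      rw [hgtr, Complex.sub_re, Complex.one_re] at hg
      linarith
    · have h1 : InSepCone (testPrepare G s₀ σ) :=
        hs₀.inSepCone.complex_smul (trace_mul_eq_ofReal hG.posSemidef hs.isState.1) hg
      refine h1.isSubSep ?_
      have h2 := (Complex.nonneg_iff.1 ((isCP_testPrepare hE.posSemidef
        (maxEnt_posSemidef m)).add (isCP_testPrepare hF.posSemidef hTS.posSemidef)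
        |>.posSemidef hs.isState.1).trace_nonneg).1
      rw [testPrepare_apply, Matrix.trace_smul, hs₀.isState.2, hgtr, smul_eq_mul, mul_one,
        Complex.sub_re, Complex.one_re]
      linarith
  · intro i σ hs
    fin_cases i
    · change InSepCone (heisenberg Φ σ)
      rw [hΦ, heisenberg_add_map, heisenberg_testPrepare, heisenberg_testPrepare]
      exact (hE.complex_smul (trace_mul_eq_ofReal hs.isState.1 (maxEnt_posSemidef m))
        (re_trace_mul_nonneg hs.isState.1 (maxEnt_posSemidef m))).add
        (hF.complex_smul (trace_mul_eq_ofReal hs.isState.1 hTS.posSemidef)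
          (re_trace_mul_nonneg hs.isState.1 hTS.posSemidef))
    · change InSepCone (heisenberg (testPrepare G s₀) σ)
      rw [heisenberg_testPrepare]
      exact hG.complex_smul (trace_mul_eq_ofReal hs.isState.1 hs₀.isState.1)
        (re_trace_mul_nonneg hs.isState.1 hs₀.isState.1)
  all_goals
    have hq := re_trace_mul_nonneg hF.posSemidef hρ.1
    set p := (E * ρ).trace.re with hp
    set q := (F * ρ).trace.re with hqdef
    have hpC : (E * ρ).trace = p := trace_mul_eq_ofReal hE.posSemidef hρ.1
    have hqC : (F * ρ).trace = q := trace_mul_eq_ofReal hF.posSemidef hρ.1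
    have hw : 0 < p + (m - 1) * q := add_pos_of_pos_of_nonneg hpos (mul_nonneg hm1 hq)
    have htr : (Φ ρ).trace = ((p + (m - 1) * q : ℝ) : ℂ) := by
      rw [hΦtr, hpC, hqC]
      push_cast
      ring
  · change (Φ ρ).trace ≠ 0
    rw [htr]
    exact_mod_cast hw.ne'
  · change 1 - (ε : ℝ) ≤ fidelity ((Φ ρ).trace⁻¹ • Φ ρ) (maxEnt m)
    have hX : (Φ ρ).PosSemidef := ((isCP_testPrepare hE.posSemidef
        (maxEnt_posSemidef m)).add (isCP_testPrepare hF.posSemidef hTS.posSemidef)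
        |>.posSemidef hρ.1)
    rw [htr, ← Complex.ofReal_inv, Complex.coe_smul,
      fidelity_maxEnt hm0 (posSemidef_smul hX (inv_nonneg.2 hw.le))]
    have h1 : (maxEnt m * ((p + (m - 1) * q)⁻¹ • Φ ρ)).trace.re = p / (p + (m - 1) * q) := by
      rw [Matrix.mul_smul, Matrix.trace_smul, hΦapp, mul_add, Matrix.mul_smul, Matrix.mul_smul,
        hΨTmul, maxEnt_mul_self hm0, smul_zero, add_zero, Matrix.trace_smul, trace_maxEnt hm0,
        hpC, smul_eq_mul, mul_one, Complex.smul_re, Complex.ofReal_re, smul_eq_mul,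
        div_eq_inv_mul]
    rw [h1]
    have h2 : 1 - (ε : ℝ) ≤ p / (p + (m - 1) * q) := by
      have h3 : 1 - p / (p + (m - 1) * q) = (m - 1) * q / (p + (m - 1) * q) := by
        field_simp
        ring
      have h4 : (m - 1) * q / (p + (m - 1) * q) ≤ (m - 1) / t := by
        rw [div_le_div_iff₀ hw ht]
        nlinarith [mul_le_mul_of_nonneg_left hle hm1, mul_nonneg hm1 (mul_nonneg hm1 hq)]
      linarith
    refine h2.trans (Real.le_sqrt_of_sq_le ?_)
    have h5 : 0 ≤ p / (p + (m - 1) * q) := by positivity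
    have h6 : p / (p + (m - 1) * q) ≤ 1 := by
      rw [div_le_one hw]
      linarith [mul_nonneg hm1 hq]
    nlinarith

end Achievability

/-! ### From distillation to ratio tests -/

section Converse

variable {a b : Type*} [Fintype a] [Fintype b]

/-- An operator close to the separable states in the Hilbert metric has small overlap with the
maximally entangled state, relative to its overlap with the complement. -/
theorem trace_maxEnt_mul_le_of_hilbertDSubSep_le {m : ℕ} (hm : 2 ≤ m) {δ : ℝ}
    {X : Matrix (Fin m × Fin m) (Fin m × Fin m) ℂ} (hX : X.PosSemidef)
    (h : hilbertDSubSep X ≤ (δ : EReal)) :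
    (m - 1) * (maxEnt m * X).trace.re ≤ 2 ^ (δ + 1) * ((1 - maxEnt m) * X).trace.re := by
  have hm0 : m ≠ 0 := by omega
  have hm1 : (0 : ℝ) ≤ m - 1 := by
    have : (2 : ℝ) ≤ m := by exact_mod_cast hm
    linarith
  have hC : (1 - maxEnt m).PosSemidef := (inSepCone_one_sub_maxEnt hm0).posSemidef
  have h1 : hilbertDSubSep X < ((δ + 1 : ℝ) : EReal) :=
    h.trans_lt (EReal.coe_lt_coe_iff.2 (by linarith))
  obtain ⟨s, h1⟩ := iInf_lt_iff.1 h1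
  obtain ⟨hs, h1⟩ := iInf_lt_iff.1 h1
  have hpow : (0 : ℝ) < 2 ^ (δ + 1) := by positivity
  have h2 : hilbertOmega X s < ENNReal.ofReal (2 ^ (δ + 1)) := by
    by_contra! hcon
    refine h1.not_ge ?_
    have h3 := log2_mono hcon
    rwa [log2_ofReal hpow, Real.logb_rpow (by norm_num) (by norm_num)] at h3
  obtain ⟨γ, h2⟩ := iInf_lt_iff.1 h2
  obtain ⟨⟨-, η, h3, h4⟩, h2⟩ := iInf_lt_iff.1 h2
  have hγ : (γ : ℝ) ≤ 2 ^ (δ + 1) := by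
    have := (ENNReal.toReal_lt_toReal ENNReal.coe_ne_top ENNReal.ofReal_ne_top).2 h2
    rw [ENNReal.toReal_ofReal hpow.le] at this
    exact this.le
  have h5 := re_trace_mul_nonneg (maxEnt_posSemidef m) h3
  have h6 := re_trace_mul_nonneg hC h4
  have h7 := hs.inSepCone.mul_trace_maxEnt_le
  have h8 := re_trace_mul_nonneg hC hX
  have h9 : ((1 - maxEnt m) * s).trace.re = s.trace.re - (maxEnt m * s).trace.re := by
    rw [sub_mul, one_mul, Matrix.trace_sub, Complex.sub_re]
  rw [Matrix.mul_sub, Matrix.mul_smul, Matrix.trace_sub, Matrix.trace_smul, Complex.sub_re,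
    Complex.smul_re, smul_eq_mul, sub_nonneg] at h5
  rw [Matrix.mul_sub, Matrix.mul_smul, Matrix.mul_smul, Matrix.trace_sub, Matrix.trace_smul,
    Matrix.trace_smul, Complex.sub_re, Complex.smul_re, Complex.smul_re, smul_eq_mul, smul_eq_mul,
    sub_nonneg] at h6
  calc (m - 1) * (maxEnt m * X).trace.re ≤ (m - 1) * (η * (maxEnt m * s).trace.re) := by gcongr
    _ = η * ((m - 1) * (maxEnt m * s).trace.re) := by ring
    _ ≤ η * ((1 - maxEnt m) * s).trace.re := by gcongr; linarith
    _ ≤ γ * ((1 - maxEnt m) * X).trace.re := h6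
    _ ≤ _ := by gcongr

/-- The bound on `tr (Ψ + (1 - Ψ) / (m + 1)) Y` in terms of `tr (1 - Ψ) Y` for outputs `Y` of
`δ`-approximately nonentangling maps on separable states. The exponent is `δ + 1` rather than `δ`
because the distance to the separable substates need not be attained. -/
def converseConst (δ : ℝ) (m : ℕ) : ℝ := 2 ^ (δ + 1) / (m - 1) + 1 / (m + 1)

theorem converseConst_pos (δ : ℝ) {m : ℕ} (hm : 2 ≤ m) : 0 < converseConst δ m := by
  have : (2 : ℝ) ≤ m := by exact_mod_cast hm
  have : (0 : ℝ) < m - 1 := by linarith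
  unfold converseConst
  positivity

/-- A dually nonentangling map pulls the separable operators `(1 + m Ψ) / (m + 1)` and `1 - Ψ` back
to a ratio test. -/
theorem Distillable.hasRatioTest [DecidableEq a] [DecidableEq b] {δ : ℝ} {m : ℕ}
    (hm : 2 ≤ m) {ρ : Matrix (a × b) (a × b) ℂ} (hρ : IsState ρ) {ε : ℝ≥0} {t : ℝ} (ht : 0 < t)
    (h : Distillable δ m ρ ε) (hε : (ε : ℝ) ≤ 1 / 4) (hεt : 4 * ε * converseConst δ m * t ≤ 1) :
    HasRatioTest t ρ := by
  obtain ⟨k, E, i, ⟨⟨⟨hCP, -⟩, hNE⟩, hdual⟩, htr, hfid⟩ := h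
  have hm0 : m ≠ 0 := by omega
  have hm1 : (0 : ℝ) < m - 1 := by
    have : (2 : ℝ) ≤ m := by exact_mod_cast hm
    linarith
  have hcone : ∀ Y, InSepCone Y → InSepCone (heisenberg (E i) Y) := by
    rintro _ ⟨s, σ, hs, hσ, rfl⟩
    rw [heisenberg_smul]
    exact (hdual i σ hσ).smul hs
  set C := converseConst δ m with hCdef
  have hC0 : 0 < C := converseConst_pos δ hm
  have hΨC : ∀ Y : Matrix (Fin m × Fin m) (Fin m × Fin m) ℂ,
      ((((m : ℝ) + 1)⁻¹ • (1 + (m : ℝ) • maxEnt m)) * Y).trace.re =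
        (maxEnt m * Y).trace.re + 1 / (m + 1) * ((1 - maxEnt m) * Y).trace.re := by
    intro Y
    rw [sub_mul, one_mul, Matrix.smul_mul, add_mul, one_mul, Matrix.smul_mul, Matrix.trace_sub,
      Matrix.trace_smul, Matrix.trace_add, Matrix.trace_smul, Complex.smul_re, Complex.add_re,
      Complex.smul_re, Complex.sub_re, smul_eq_mul, smul_eq_mul]
    field_simp
    ring
  have hX := (hCP i).posSemidef hρ.1
  have hw : 0 < (E i ρ).trace.re := (re_trace_nonneg hX).lt_of_ne' fun h0 => htr <| by
    rw [trace_eq_ofReal hX, h0, Complex.ofReal_zero]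
  set w := (E i ρ).trace.re with hwdef
  rw [trace_eq_ofReal hX, ← Complex.ofReal_inv, Complex.coe_smul,
    fidelity_maxEnt hm0 (posSemidef_smul hX (inv_nonneg.2 hw.le)), Matrix.mul_smul,
    Matrix.trace_smul, Complex.smul_re, smul_eq_mul] at hfid
  set f := (maxEnt m * E i ρ).trace.re with hf
  have hcompl : ((1 - maxEnt m) * E i ρ).trace.re = w - f := by
    rw [sub_mul, one_mul, Matrix.trace_sub, Complex.sub_re]
  have hfw : 0 ≤ w - f := hcompl ▸
    re_trace_mul_nonneg (inSepCone_one_sub_maxEnt hm0).posSemidef hX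
  have hεw : (1 - 2 * (ε : ℝ)) * w ≤ f := by
    have h1 : (1 - (ε : ℝ)) ^ 2 ≤ w⁻¹ * f := by
      refine (Real.le_sqrt' (by linarith)).1 hfid
    have h2 : (1 - (ε : ℝ)) ^ 2 * w ≤ f := by
      have := mul_le_mul_of_nonneg_right h1 hw.le
      rwa [mul_comm w⁻¹, inv_mul_cancel_right₀ hw.ne'] at this
    nlinarith [mul_nonneg (sq_nonneg (ε : ℝ)) hw.le]
  have hinv : (0 : ℝ) ≤ 1 / (m + 1) := by positivity
  refine ⟨heisenberg (E i) (((m : ℝ) + 1)⁻¹ • (1 + (m : ℝ) • maxEnt m)),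
    C • heisenberg (E i) (1 - maxEnt m),
    hcone _ ((inSepCone_one_add_maxEnt hm0).smul (by positivity)),
    (hcone _ (inSepCone_one_sub_maxEnt hm0)).smul hC0.le, fun σ hσ => ?_, ?_, ?_⟩
  · rw [trace_heisenberg_mul, hΨC, Matrix.smul_mul, Matrix.trace_smul, Complex.smul_re,
      trace_heisenberg_mul, smul_eq_mul]
    have h1 := trace_maxEnt_mul_le_of_hilbertDSubSep_le hm ((hCP i).posSemidef hσ.isState.1)
      (hNE i σ hσ)
    have h2 : (maxEnt m * E i σ).trace.re ≤
        2 ^ (δ + 1) / (m - 1) * ((1 - maxEnt m) * E i σ).trace.re := by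
      rw [div_mul_eq_mul_div, le_div_iff₀ hm1]
      linarith
    rw [hCdef, converseConst, add_mul]
    linarith
  · rw [trace_heisenberg_mul, hΨC, hcompl]
    nlinarith [mul_nonneg hinv hfw]
  · rw [trace_heisenberg_mul, hΨC, Matrix.smul_mul, Matrix.trace_smul, Complex.smul_re,
      trace_heisenberg_mul, smul_eq_mul, hcompl]
    have h1 : t * (C * (w - f)) ≤ t * (C * (2 * ε * w)) := by
      gcongr
      linarith
    have h2 : t * (C * (2 * ε * w)) ≤ w / 2 := by
      have := mul_le_mul_of_nonneg_right hεt hw.le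
      linarith
    nlinarith [mul_nonneg hinv hfw]

end Converse

/-! ### Superadditive sequences of extended reals -/

section Fekete

open Filter Topology

/-- Fekete's lemma for nonnegative superadditive sequences that may take the value `∞`. -/
theorem tendsto_div_of_superadditive {f : ℕ → EReal} (h0 : ∀ n, 0 ≤ f n)
    (hadd : ∀ n m, f n + f m ≤ f (n + m)) :
    Tendsto (fun n : ℕ => f n / ((n : ℝ) : EReal)) atTop
      (𝓝 (⨆ (n : ℕ) (_ : 1 ≤ n), f n / ((n : ℝ) : EReal))) := by
  have hnn : ∀ n : ℕ, (0 : EReal) ≤ ((n : ℝ) : EReal) :=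
    fun n => EReal.coe_nonneg.2 (Nat.cast_nonneg n)
  refine tendsto_order.2 ⟨fun a ha => ?_, fun a ha => ?_⟩
  · obtain ⟨N, ha⟩ := lt_iSup_iff.1 ha
    obtain ⟨hN, ha⟩ := lt_iSup_iff.1 ha
    rcases lt_or_ge a 0 with ha0 | ha0
    · exact Eventually.of_forall fun n => ha0.trans_le (EReal.div_nonneg (h0 n) (hnn n))
    obtain ⟨c, hac, hc⟩ := EReal.lt_iff_exists_real_btwn.1 ha
    obtain ⟨a', haa', ha'c⟩ := EReal.lt_iff_exists_real_btwn.1 hac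
    have hc0 : 0 ≤ c := EReal.coe_nonneg.1 (ha0.trans hac.le)
    have ha'c : a' < c := EReal.coe_lt_coe_iff.1 ha'c
    have hN0 : (0 : EReal) < ((N : ℝ) : EReal) := EReal.coe_pos.2 (Nat.cast_pos.2 hN)
    have hcN : ((c * N : ℝ) : EReal) ≤ f N := by
      rw [EReal.coe_mul]
      exact ((EReal.lt_div_iff hN0 (EReal.coe_ne_top _)).1 hc).le
    have hmul : ∀ q : ℕ, ((q * (c * N) : ℝ) : EReal) ≤ f (q * N) := by
      intro q
      induction q with
      | zero => simpa using h0 0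
      | succ q ih =>
        rw [Nat.succ_mul, Nat.cast_succ, add_mul, one_mul, EReal.coe_add]
        exact (add_le_add ih hcN).trans (hadd _ _)
    have hev : ∀ᶠ n : ℕ in atTop, N * c / (c - a') ≤ (n : ℝ) :=
      tendsto_natCast_atTop_atTop.eventually_ge_atTop _
    filter_upwards [hev, eventually_ge_atTop 1] with n hn hn1
    refine haa'.trans_le ((EReal.le_div_iff_mul_le (EReal.coe_pos.2 (Nat.cast_pos.2 hn1))
      (EReal.coe_ne_top _)).2 ?_)
    have h1 : f (n / N * N) ≤ f n := by
      calc f (n / N * N) = f (n / N * N) + 0 := (add_zero _).symm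
        _ ≤ f (n / N * N) + f (n % N) := by gcongr; exact h0 _
        _ ≤ f (n / N * N + n % N) := hadd _ _
        _ = f n := by rw [Nat.div_add_mod']
    refine le_trans ?_ ((hmul (n / N)).trans h1)
    rw [← EReal.coe_mul, EReal.coe_le_coe_iff]
    rw [div_le_iff₀ (by linarith)] at hn
    have h2 : (n : ℝ) ≤ (n / N : ℕ) * N + N := by
      have h3 := Nat.div_add_mod' n N
      have h4 := Nat.mod_lt n hN
      have h5 : n ≤ n / N * N + N := by omega
      exact_mod_cast h5
    nlinarith [mul_le_mul_of_nonneg_right h2 hc0]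
  · filter_upwards [eventually_ge_atTop 1] with n hn
    exact (le_iSup₂ (f := fun (n : ℕ) (_ : 1 ≤ n) => f n / ((n : ℝ) : EReal)) n hn).trans_lt ha

/-- A bounded perturbation does not affect the growth rate. -/
theorem tendsto_add_const_div {f : ℕ → EReal} {L : EReal} (K : ℝ)
    (h : Tendsto (fun n : ℕ => f n / ((n : ℝ) : EReal)) atTop (𝓝 L)) :
    Tendsto (fun n : ℕ => (f n + K) / ((n : ℝ) : EReal)) atTop (𝓝 L) := by
  have h1 : Tendsto (fun n : ℕ => ((K / n : ℝ) : EReal)) atTop (𝓝 ((0 : ℝ) : EReal)) :=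
    (continuous_coe_real_ereal.tendsto 0).comp (tendsto_const_div_atTop_nhds_zero_nat K)
  have h2 := (EReal.continuousAt_add (p := (L, ((0 : ℝ) : EReal)))
    (Or.inr (EReal.coe_ne_bot _)) (Or.inr (EReal.coe_ne_top _))).tendsto.comp
    (h.prodMk_nhds h1)
  simp only [EReal.coe_zero, add_zero] at h2
  refine h2.congr fun n => ?_
  rw [EReal.add_div_of_nonneg_right (EReal.coe_nonneg.2 (Nat.cast_nonneg n)), ← EReal.coe_div]
  rfl

end Fekete

/-! ### The regularized quantity and the exponent -/

section Asymptotics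

open Filter Topology

variable {a b : Type*} [Fintype a] [Fintype b] [DecidableEq a] [DecidableEq b]

theorem one_le_omegaHatSEP {ρ : Matrix (a × b) (a × b) ℂ} (hρ : IsState ρ) :
    1 ≤ omegaHatSEP ρ := by
  have := hρ.nonempty
  have : Nonempty a := (nonempty_prod.1 this).1
  have : Nonempty b := (nonempty_prod.1 ‹Nonempty (a × b)›).2
  have h : HasRatioTest 1 ρ := ⟨1, 1, InSepCone.one, InSepCone.one, fun σ _ => le_rfl,
    by rw [one_mul, hρ.2]; simp, by rw [one_mul]⟩
  simpa using h.le_omegaHatSEP hρ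

/-- Supermultiplicativity of `Ω̂_Sep^SEP` on tensor powers. -/
theorem omegaHatSEP_tensorPow_mul_le {ρ : Matrix (a × b) (a × b) ℂ} (hρ : IsState ρ) (n m : ℕ) :
    omegaHatSEP (tensorPow n ρ) * omegaHatSEP (tensorPow m ρ) ≤
      omegaHatSEP (tensorPow (n + m) ρ) := by
  have := hρ.nonempty
  have : Nonempty a := (nonempty_prod.1 this).1
  have : Nonempty b := (nonempty_prod.1 ‹Nonempty (a × b)›).2
  refine ENNReal.mul_le_of_forall_lt fun s hs t ht => ?_
  rcases eq_or_ne s 0 with rfl | hs0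
  · simp
  rcases eq_or_ne t 0 with rfl | ht0
  · simp
  have hs' := (ENNReal.toReal_pos hs0 hs.ne_top)
  have ht' := (ENNReal.toReal_pos ht0 ht.ne_top)
  rw [← ENNReal.ofReal_toReal (ENNReal.mul_ne_top hs.ne_top ht.ne_top), ENNReal.toReal_mul]
  rw [← ENNReal.ofReal_toReal hs.ne_top] at hs
  rw [← ENNReal.ofReal_toReal ht.ne_top] at ht
  have h := (hasRatioTest_of_lt_omegaHatSEP (hρ.tensorPow n) hs' hs).bipartiteTensor
    (ea := (Fin.appendEquiv n m).symm) (eb := (Fin.appendEquiv n m).symm) (hρ.tensorPow n).1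
    (hρ.tensorPow m).1 ht'.le (hasRatioTest_of_lt_omegaHatSEP (hρ.tensorPow m) ht' ht)
  rw [← tensorPow_add] at h
  exact h.le_omegaHatSEP (hρ.tensorPow _)

theorem log2_omegaHatSEP_nonneg {ρ : Matrix (a × b) (a × b) ℂ} (hρ : IsState ρ) :
    0 ≤ log2 (omegaHatSEP ρ) := by
  rw [← log2_one]
  exact log2_mono (one_le_omegaHatSEP hρ)

theorem tendsto_dHatSEPSeq {ρ : Matrix (a × b) (a × b) ℂ} (hρ : IsState ρ) :
    Tendsto (dHatSEPSeq ρ) atTop (𝓝 (dHatSEPReg ρ)) :=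
  tendsto_nhds_limUnder ⟨_, tendsto_div_of_superadditive
    (f := fun n => log2 (omegaHatSEP (tensorPow n ρ)))
    (fun n => log2_omegaHatSEP_nonneg (hρ.tensorPow n)) fun n m => by
      rw [← log2_mul]
      exact log2_mono (omegaHatSEP_tensorPow_mul_le hρ n m)⟩

/-- The single-copy converse bound, with an additive constant independent of the state. -/
theorem Distillable.neg_log2_le {δ : ℝ} {m : ℕ} (hm : 2 ≤ m) {ρ : Matrix (a × b) (a × b) ℂ}
    (hρ : IsState ρ) {ε : ℝ≥0} (h : Distillable δ m ρ ε) :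
    -log2 ε ≤ log2 (omegaHatSEP ρ) +
      ((max 2 (Real.logb 2 (4 * converseConst δ m)) : ℝ) : EReal) := by
  set C := converseConst δ m with hC
  have hC0 : 0 < C := converseConst_pos δ hm
  set K := max 2 (Real.logb 2 (4 * C)) with hK
  have hΩ := log2_omegaHatSEP_nonneg hρ
  rcases le_or_gt (ε : ℝ) (1 / 4) with hε | hε
  · rcases eq_or_ne ε 0 with rfl | hε0
    · have htop : omegaHatSEP ρ = ⊤ := ENNReal.eq_top_of_forall_nnreal_le fun r => by
        have h1 := (h.hasRatioTest hm hρ (t := r + 1) (by positivity) hε (by simp)).le_omegaHatSEP hρ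
        refine le_trans ?_ h1
        rw [← ENNReal.ofReal_coe_nnreal]
        exact ENNReal.ofReal_le_ofReal (by linarith)
      rw [htop, log2_top, EReal.top_add_coe]
      exact le_top
    · have hε' : 0 < (ε : ℝ) := by positivity
      have h1 := (h.hasRatioTest hm hρ (t := (4 * ε * C)⁻¹) (by positivity) hε
        (mul_inv_cancel₀ (by positivity)).le).le_omegaHatSEP hρ
      have h2 := log2_mono h1
      rw [log2_ofReal (by positivity), Real.logb_inv, mul_right_comm,
        Real.logb_mul (by positivity) hε'.ne'] at h2
      rw [← ENNReal.ofReal_coe_nnreal, log2_ofReal hε']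
      calc -((Real.logb 2 ε : ℝ) : EReal) =
            ((-(Real.logb 2 (4 * C) + Real.logb 2 ε) : ℝ) : EReal) +
              ((Real.logb 2 (4 * C) : ℝ) : EReal) := by
            rw [← EReal.coe_add, ← EReal.coe_neg]
            congr 1
            ring
        _ ≤ _ := add_le_add h2 (EReal.coe_le_coe_iff.2 (le_max_right _ _))
  · have hε' : 0 < (ε : ℝ) := by linarith
    have h1 : -Real.logb 2 ε ≤ 2 := by
      rw [← Real.logb_inv, Real.logb_le_iff_le_rpow one_lt_two (by positivity)]
      rw [inv_le_comm₀ hε' (by positivity)]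
      norm_num
      linarith
    rw [← ENNReal.ofReal_coe_nnreal, log2_ofReal hε', ← EReal.coe_neg]
    calc ((-Real.logb 2 ε : ℝ) : EReal) ≤ ((K : ℝ) : EReal) :=
          EReal.coe_le_coe_iff.2 (h1.trans (le_max_left _ _))
      _ = 0 + (K : EReal) := (zero_add _).symm
      _ ≤ _ := add_le_add hΩ le_rfl

theorem distillExponent_eq {ρ : Matrix (a × b) (a × b) ℂ} (hρ : IsState ρ) {δ : ℝ} (hδ : 0 ≤ δ)
    {m : ℕ} (hm : 2 ≤ m) : distillExponent δ m ρ = dHatSEPReg ρ := by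
  have hlim := tendsto_dHatSEPSeq hρ
  refine le_antisymm (sSup_le ?_) (le_sSup ?_)
  · rintro r ⟨ε, hε, hr⟩
    refine le_of_tendsto_of_tendsto hr (tendsto_add_const_div
      (max 2 (Real.logb 2 (4 * converseConst δ m))) hlim) ?_
    filter_upwards [eventually_ge_atTop 1] with n hn
    exact EReal.div_le_div_right_of_nonneg (EReal.coe_nonneg.2 (Nat.cast_nonneg n))
      ((hε n hn).neg_log2_le hm (hρ.tensorPow n))
  · have hm1 : (0 : ℝ) < m - 1 := by
      have : (2 : ℝ) ≤ m := by exact_mod_cast hm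
      linarith
    -- The factor `2` makes the inverse error times `m - 1` strictly smaller than `Ω̂`.
    set c : ℝ := 1 / (2 * (m - 1)) with hc
    have hc0 : 0 < c := by positivity
    -- The cap `2 ^ n²` keeps the inverse error finite, and its rate `n` is eventually irrelevant.
    set κ : ℕ → ℝ≥0∞ := fun n =>
      min (omegaHatSEP (tensorPow n ρ) * ENNReal.ofReal c) (ENNReal.ofReal (2 ^ ((n : ℝ) ^ 2)))
    have hκ0 : ∀ n, κ n ≠ 0 := fun n => by
      have h1 := (zero_lt_one.trans_le (one_le_omegaHatSEP (hρ.tensorPow n))).ne'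
      have h2 : (0 : ℝ) < 2 ^ ((n : ℝ) ^ 2) := by positivity
      refine (lt_min (pos_iff_ne_zero.2 (mul_ne_zero h1 ?_)) ?_).ne'
      · simpa using hc0
      · simpa using h2
    have hκt : ∀ n, κ n ≠ ⊤ := fun n => ((min_le_right _ _).trans_lt ENNReal.ofReal_lt_top).ne
    have hcoe : ∀ n, (((κ n)⁻¹.toNNReal : ℝ≥0) : ℝ≥0∞) = (κ n)⁻¹ := fun n =>
      ENNReal.coe_toNNReal (ENNReal.inv_ne_top.2 (hκ0 n))
    refine ⟨fun n => (κ n)⁻¹.toNNReal, fun n _ => ?_, ?_⟩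
    · have hpos : 0 < (κ n).toReal := ENNReal.toReal_pos (hκ0 n) (hκt n)
      refine distillable_of_hasRatioTest hδ hm (hρ.tensorPow n) (t := (m - 1) * (κ n).toReal)
        (by positivity) (hasRatioTest_of_lt_omegaHatSEP (hρ.tensorPow n) (by positivity) ?_) ?_
      · rcases eq_or_ne (omegaHatSEP (tensorPow n ρ)) ⊤ with htop | htop
        · rw [htop]
          exact ENNReal.ofReal_lt_top
        · rw [ENNReal.ofReal_lt_iff_lt_toReal (by positivity) htop]
          have h1 : (κ n).toReal ≤ (omegaHatSEP (tensorPow n ρ)).toReal * c := by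
            have := ENNReal.toReal_mono (ENNReal.mul_ne_top htop ENNReal.ofReal_ne_top)
              (min_le_left (omegaHatSEP (tensorPow n ρ) * ENNReal.ofReal c)
                (ENNReal.ofReal (2 ^ ((n : ℝ) ^ 2))))
            rwa [ENNReal.toReal_mul, ENNReal.toReal_ofReal hc0.le] at this
          have h2 : 0 < (omegaHatSEP (tensorPow n ρ)).toReal := ENNReal.toReal_pos
            (zero_lt_one.trans_le (one_le_omegaHatSEP (hρ.tensorPow n))).ne' htop
          calc (m - 1) * (κ n).toReal ≤
                (m - 1) * ((omegaHatSEP (tensorPow n ρ)).toReal * c) := by gcongr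
            _ = (omegaHatSEP (tensorPow n ρ)).toReal / 2 := by
                rw [hc]
                field_simp
            _ < _ := by linarith
      · have : (((κ n)⁻¹.toNNReal : ℝ≥0) : ℝ) = (κ n).toReal⁻¹ := by
          rw [← ENNReal.toReal_inv]
          rfl
        rw [this]
        refine le_of_eq ?_
        field_simp
    · have h1 := (tendsto_add_const_div (Real.logb 2 c) hlim).min
        (EReal.tendsto_coe_atTop.comp tendsto_natCast_atTop_atTop)
      rw [min_top_right] at h1
      refine h1.congr fun n => ?_
      have h2 : (((n : ℝ) ^ 2 : ℝ) : EReal) / ((n : ℝ) : EReal) = ((n : ℝ) : EReal) := by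
        rw [← EReal.coe_div, pow_two, mul_self_div_self]
      rw [hcoe, log2_inv, neg_neg, log2_mono.map_min, (EReal.monotone_div_right_of_nonneg
        (EReal.coe_nonneg.2 (Nat.cast_nonneg n))).map_min, log2_mul, log2_ofReal hc0,
        log2_ofReal (by positivity), Real.logb_rpow (by norm_num) (by norm_num), h2]
      rfl

end Asymptotics

end Distill

end

theorem theorem2 {a b : Type*} [Fintype a] [Fintype b] [DecidableEq a] [DecidableEq b]
    (ρ : Matrix (a × b) (a × b) ℂ) (hρ : Distill.IsState ρ) (δ : ℝ) (hδ : 0 ≤ δ) :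
    Filter.Tendsto (Distill.dHatSEPSeq ρ) Filter.atTop (nhds (Distill.dHatSEPReg ρ)) ∧
    (∀ m : ℕ, 2 ≤ m → Distill.distillExponent δ m ρ = Distill.dHatSEPReg ρ) ∧
    Filter.Tendsto (fun m : ℕ => Distill.distillExponent δ m ρ) Filter.atTop
      (nhds (Distill.dHatSEPReg ρ)) := by
  have h : ∀ m : ℕ, 2 ≤ m → Distill.distillExponent δ m ρ = Distill.dHatSEPReg ρ :=
    fun m hm => Distill.distillExponent_eq hρ hδ hm
  refine ⟨Distill.tendsto_dHatSEPSeq hρ, h, tendsto_const_nhds.congr' ?_⟩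
  filter_upwards [Filter.eventually_ge_atTop 2] with m hm
  exact (h m hm).symm
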